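/- Let $(V,Y,\mathbf 1,\omega)$ be a vertex operator algebra over $\mathbb C$ of CFT type, i.e. $V=\bigoplus_{n\ge 0}V_n$ with $V_0=\mathbb C\mathbf 1$, where $V_n$ is the space of vectors of weight $n$ (the $L(0)$-eigenspace with eigenvalue $n$), and write $Y(a,z)=\sum_{n\in\mathbb Z}a_{(n)}z^{-n-1}$. Let $g$ be an automorphism of $V$ of finite order $T$, and for $0\le r\le T-1$ put $V^r=\{a\in V: ga=e^{2\pi i r/T}a\}$, $\delta(0)=1$, and $\delta(r)=0$ for $r\ne 0$. Let $C_2(V)$ be the span of all $a_{(-2)}b$ with $a,b\in V$, and let $R(V)=V/C_2(V)$, a commutative associative algebra with identity $\mathbf 1+C_2(V)$ under $(a+C_2(V))\cdot(b+C_2(V))=a_{(-1)}b+C_2(V)$. Let $O_g(V)$ be the span of all $$\operatorname{Res}_z\frac{(1+z)^{m-1+\delta(r)+r/T}}{z^{1+\delta(r)}}\,Y(a,z)b,\qquad 0\le r\le T-1,\ m\ge 0,\ a\in V^r\cap V_m,\ b\in V,$$ and let $A_g(V)=V/O_g(V)$, with $[a]$ denoting the class of $a$. It is an associative algebra with identity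 $[\mathbf 1]$ under the product induced by the bilinear operation $*_g$ on $V$ with $a*_g b=\operatorname{Res}_z\frac{(1+z)^m}{z}Y(a,z)b$ for $a\in V^0\cap V_m$ and $a*_gb=0$ for $a\in V^r$, $r\neq 0$. For $n\in\mathbb Z$ let $A_g(V)_n$ be the image of $\bigoplus_{0\le i\le n}V_i$ in $A_g(V)$. Then $A_g(V)_{-1}=0$ and $A_g(V)_m *_g A_g(V)_n\subseteq A_g(V)_{m+n}$ for $m,n\ge 0$, and $\operatorname{gr}A_g(V)=\bigoplus_{n\ge 0}A_g(V)_n/A_g(V)_{n-1}$, with product $(x+A_g(V)_{m-1})*_g(y+A_g(V)_{n-1})=x*_gy+A_g(V)_{m+n-1}$ for $x\in A_g(V)_m$, $y\in A_g(V)_n$, is a commutative associative algebra with identity $[\mathbf 1]+A_g(V)_{-1}$. Let $\phi:V\to\operatorname{gr}A_g(V)$ be the linear map with $\phi(a)=[a]+A_g(V)_{m-1}\in A_g(V)_m/A_g(V)_{m-1}$ for every $m\ge 0$ and every homogeneous $a\in V_m$. Then $\phi(C_2(V))=0$, and $\phi$ induces an epimorphism (a surjective unital homomorphism) of commutative associative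 algebras $$R(V)=V/C_2(V)\longrightarrow\operatorname{gr}A_g(V),\qquad a+C_2(V)\longmapsto[a]+A_g(V)_{m-1}\quad(a\in V_m).$$ -/

import Mathlib

open scoped DirectSum

noncomputable section

/-- A vertex operator algebra over `ℂ` with underlying vector space `V`: state-field correspondence
`Y`, vacuum `vac`, conformal vector `omega`. The `n`-th mode of `a` is
`a_n = VertexOperator.ncoeff (Y a) n`, so that `Y(a,z) b = ∑ a_n b z^(-n-1)`; that this is a Laurent
series in `z` (truncation) is part of the type `VertexOperator ℂ V`. The `n`-th Virasoro mode is
`L(n) = omega_(n+1)`, and the grading of `V` is the one by eigenspaces of `L(0)`. -/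
structure VertexOperatorAlgebra (V : Type*) [AddCommGroup V] [Module ℂ V] where
  Y : V →ₗ[ℂ] VertexOperator ℂ V
  vac : V
  omega : V
  centralCharge : ℂ
  /-- `Y(1,z) = id`. -/
  vacuum : ∀ (n : ℤ) (a : V), VertexOperator.ncoeff (Y vac) n a = if n = -1 then a else 0
  /-- `Y(a,z)1` is a power series in `z` -/
  creation : ∀ (a : V) (n : ℤ), 0 ≤ n → VertexOperator.ncoeff (Y a) n vac = 0
  /-- with constant term `a`. -/
  creation_neg_one : ∀ a : V, VertexOperator.ncoeff (Y a) (-1) vac = a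
  /-- The Jacobi identity, in components (all the sums have finite support, by truncation). -/
  jacobi : ∀ (a b c : V) (l m n : ℤ),
    ∑ᶠ i : ℕ, ((-1 : ℤ) ^ i * Ring.choose l i) •
        (VertexOperator.ncoeff (Y a) (m + l - i) (VertexOperator.ncoeff (Y b) (n + i) c)
          - Int.negOnePow l •
            VertexOperator.ncoeff (Y b) (n + l - i) (VertexOperator.ncoeff (Y a) (m + i) c))
      = ∑ᶠ j : ℕ, Ring.choose m j •
          VertexOperator.ncoeff (Y (VertexOperator.ncoeff (Y a) (l + j) b)) (m + n - j) c
  /-- The Virasoro relations. -/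
  virasoro : ∀ (m n : ℤ) (a : V),
    VertexOperator.ncoeff (Y omega) (m + 1) (VertexOperator.ncoeff (Y omega) (n + 1) a)
        - VertexOperator.ncoeff (Y omega) (n + 1) (VertexOperator.ncoeff (Y omega) (m + 1) a)
      = ((m : ℂ) - n) • VertexOperator.ncoeff (Y omega) (m + n + 1) a
        + (if m + n = 0 then ((m : ℂ) ^ 3 - m) / 12 * centralCharge else 0) • a
  /-- `Y(L(-1)a,z) = d/dz Y(a,z)`. -/
  derivative : ∀ (a b : V) (n : ℤ),
    VertexOperator.ncoeff (Y (VertexOperator.ncoeff (Y omega) 0 a)) n b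
      = (-(n : ℂ)) • VertexOperator.ncoeff (Y a) (n - 1) b
  /-- `V` is the direct sum of the eigenspaces of `L(0)` with integral eigenvalues, -/
  grading : DirectSum.IsInternal fun n : ℤ =>
    Module.End.eigenspace (VertexOperator.ncoeff (Y omega) 1) (n : ℂ)
  /-- which are finite-dimensional -/
  finiteDimensional : ∀ n : ℤ, FiniteDimensional ℂ
    (Module.End.eigenspace (VertexOperator.ncoeff (Y omega) 1) (n : ℂ))
  /-- and vanish in sufficiently negative degrees. -/
  bounded_below : ∃ N : ℤ, ∀ n : ℤ, n < N →
    Module.End.eigenspace (VertexOperator.ncoeff (Y omega) 1) (n : ℂ) = ⊥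

namespace VertexOperatorAlgebra

variable {V : Type*} [AddCommGroup V] [Module ℂ V] (S : VertexOperatorAlgebra V)

/-- The mode `a_n`. -/
def mode (a : V) (n : ℤ) : V →ₗ[ℂ] V := VertexOperator.ncoeff (S.Y a) n

theorem exists_mode_eq_zero (a b : V) : ∃ N : ℤ, ∀ n : ℤ, N ≤ n → S.mode a n b = 0 := by
  refine ⟨-((HahnModule.of ℂ).symm (S.Y a b)).order, fun n hn => ?_⟩
  exact VertexOperator.ncoeff_eq_zero_of_lt_order _ _ _ (by omega)

/-- The space `V_n` of vectors of weight `n`. -/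
def weightSpace (n : ℤ) : Submodule ℂ V := Module.End.eigenspace (S.mode S.omega 1) (n : ℂ)

theorem bijective_coeLinearMap : Function.Bijective (DirectSum.coeLinearMap S.weightSpace) :=
  S.grading

theorem vac_mem_weightSpace : S.vac ∈ S.weightSpace ((0 : ℕ) : ℤ) := by
  rw [weightSpace, Module.End.mem_eigenspace_iff]
  rw [show S.mode S.omega 1 S.vac = 0 from S.creation S.omega 1 zero_le_one]
  simp

/-- `V` is of CFT type: `V = ⊕_{n ≥ 0} V_n` and `V_0 = ℂ 1`. -/
structure IsCFTType : Prop where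
  nonneg : ∀ n : ℤ, n < 0 → S.weightSpace n = ⊥
  zero : S.weightSpace 0 = Submodule.span ℂ {S.vac}

/-- `g` is an automorphism of the vertex operator algebra. -/
structure IsAutomorphism (g : V ≃ₗ[ℂ] V) : Prop where
  map_mode : ∀ (a b : V) (n : ℤ), g (S.mode a n b) = S.mode (g a) n (g b)
  map_vac : g S.vac = S.vac
  map_omega : g S.omega = S.omega

/-- `Res_z (1+z)^α z^k Y(a,z) b = ∑_{j ≥ 0} (α choose j) a_(j+k) b`, a finite sum. -/
def res (α : ℂ) (k : ℤ) (a b : V) : V := ∑ᶠ j : ℕ, Ring.choose α j • S.mode a (j + k) b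

theorem res_finite_support (α : ℂ) (k : ℤ) (a b : V) :
    (Function.support fun j : ℕ => Ring.choose α j • S.mode a (j + k) b).Finite := by
  obtain ⟨N, hN⟩ := S.exists_mode_eq_zero a b
  refine (Set.finite_lt_nat (N - k).toNat).subset fun j hj => ?_
  by_contra h
  refine hj ?_
  have : N ≤ (j : ℤ) + k := by
    simp only [Set.mem_ofPred_eq, not_lt] at h
    omega
  simp [hN _ this]

/-- `C_2(V)`, the span of all `a_(-2) b`. -/
def C2 : Submodule ℂ V := Submodule.span ℂ {x | ∃ a b : V, x = S.mode a (-2) b}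

/-- `R(V) = V / C_2(V)`. -/
abbrev R : Type _ := V ⧸ S.C2

/-- The eigenspace `V^r = {a | g a = e^(2πi r/T) a}`. -/
def eigen (g : V ≃ₗ[ℂ] V) (T r : ℕ) : Submodule ℂ V :=
  Module.End.eigenspace (g : V →ₗ[ℂ] V) (Complex.exp (2 * Real.pi * Complex.I * (r / T)))

/-- `δ(r)`. -/
def delta (r : ℕ) : ℤ := if r = 0 then 1 else 0

/-- `a ∘_g b = Res_z (1+z)^(m-1+δ(r)+r/T) z^(-1-δ(r)) Y(a,z) b` for `a ∈ V^r` of weight `m`. -/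
def circ (T r : ℕ) (m : ℤ) (a b : V) : V :=
  S.res ((m : ℂ) - 1 + (delta r : ℂ) + r / T) (-1 - delta r) a b

/-- `O_g(V)`, the span of all `a ∘_g b` with `a ∈ V^r` homogeneous and `b ∈ V`. -/
def Og (g : V ≃ₗ[ℂ] V) (T : ℕ) : Submodule ℂ V :=
  Submodule.span ℂ {x | ∃ r : ℕ, r < T ∧ ∃ (m : ℤ) (a b : V),
    a ∈ eigen g T r ∧ a ∈ S.weightSpace m ∧ x = S.circ T r m a b}

/-- `A_g(V) = V / O_g(V)`. -/
abbrev Ag (g : V ≃ₗ[ℂ] V) (T : ℕ) : Type _ := V ⧸ S.Og g T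

/-- The class `[a]` of `a` in `A_g(V)`. -/
abbrev cls (g : V ≃ₗ[ℂ] V) (T : ℕ) : V →ₗ[ℂ] S.Ag g T := (S.Og g T).mkQ

/-- `μ` is the product of `A_g(V)` induced by `*_g`, where
`a *_g b = Res_z (1+z)^m z^(-1) Y(a,z) b` for `a ∈ V^0` of weight `m`,
and `a *_g b = 0` for `a ∈ V^r`, `r ≠ 0`. -/
structure IsTwistedZhuProduct (g : V ≃ₗ[ℂ] V) (T : ℕ)
    (μ : S.Ag g T →ₗ[ℂ] S.Ag g T →ₗ[ℂ] S.Ag g T) : Prop where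
  of_mem_zero : ∀ (m : ℤ) (a b : V), a ∈ eigen g T 0 → a ∈ S.weightSpace m →
    μ (S.cls g T a) (S.cls g T b) = S.cls g T (S.res m (-1) a b)
  of_mem_pos : ∀ (r : ℕ) (a b : V), 0 < r → r < T → a ∈ eigen g T r →
    μ (S.cls g T a) (S.cls g T b) = 0

/-- The weight filtration: `A_g(V)_n` is the image of `⊕_{0 ≤ i ≤ n} V_i` in `A_g(V)`. -/
def filt (g : V ≃ₗ[ℂ] V) (T : ℕ) (n : ℤ) : Submodule ℂ (S.Ag g T) :=
  (⨆ (i : ℕ) (_ : (i : ℤ) ≤ n), S.weightSpace i).map (S.cls g T)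

/-- `gr A_g(V) = ⊕_{n ≥ 0} A_g(V)_n / A_g(V)_(n-1)`. -/
abbrev Gr (g : V ≃ₗ[ℂ] V) (T : ℕ) : Type _ :=
  ⨁ n : ℕ, (S.filt g T n ⧸ (S.filt g T ((n : ℤ) - 1)).submoduleOf (S.filt g T n))

/-- The class `x + A_g(V)_(n-1)` of `x ∈ A_g(V)_n` in `gr A_g(V)`. -/
def symb (g : V ≃ₗ[ℂ] V) (T n : ℕ) : S.filt g T n →ₗ[ℂ] S.Gr g T :=
  (DirectSum.lof ℂ ℕ
      (fun n : ℕ => S.filt g T n ⧸ (S.filt g T ((n : ℤ) - 1)).submoduleOf (S.filt g T n)) n).comp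
    ((S.filt g T ((n : ℤ) - 1)).submoduleOf (S.filt g T n)).mkQ

theorem cls_mem_filt (g : V ≃ₗ[ℂ] V) (T n : ℕ) {a : V} (ha : a ∈ S.weightSpace n) :
    S.cls g T a ∈ S.filt g T n :=
  Submodule.mem_map_of_mem (Submodule.mem_iSup_of_mem n (Submodule.mem_iSup_of_mem le_rfl ha))

/-- The class `[1] + A_g(V)_(-1)` in `gr A_g(V)`. -/
def grOne (g : V ≃ₗ[ℂ] V) (T : ℕ) : S.Gr g T :=
  S.symb g T 0 ⟨S.cls g T S.vac, S.cls_mem_filt g T 0 S.vac_mem_weightSpace⟩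

/-- `a ↦ [a] + A_g(V)_(n-1)` on `V_n`, for `n ≥ 0`. -/
def symbWeight (g : V ≃ₗ[ℂ] V) (T n : ℕ) : S.weightSpace n →ₗ[ℂ] S.Gr g T :=
  (S.symb g T n).comp
    (((S.cls g T).comp (S.weightSpace n).subtype).codRestrict (S.filt g T n)
      fun a => S.cls_mem_filt g T n a.2)

/-- The linear map `V → gr A_g(V)` which is `a ↦ [a] + A_g(V)_(n-1)` on `V_n` for `n ≥ 0`
(and `0` on `V_n` for `n < 0`, which is irrelevant for `V` of CFT type, where `V_n = 0`). -/
def grMap (g : V ≃ₗ[ℂ] V) (T : ℕ) : V →ₗ[ℂ] S.Gr g T :=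
  (DirectSum.toModule ℂ ℤ (S.Gr g T) fun n : ℤ =>
      (match n with
      | Int.ofNat n => S.symbWeight g T n
      | Int.negSucc _ => 0 : S.weightSpace n →ₗ[ℂ] S.Gr g T)).comp
    (LinearEquiv.ofBijective (DirectSum.coeLinearMap S.weightSpace) S.bijective_coeLinearMap).symm.toLinearMap

theorem grMap_of_mem (g : V ≃ₗ[ℂ] V) (T n : ℕ) {a : V} (ha : a ∈ S.weightSpace n) :
    S.grMap g T a = S.symb g T n ⟨S.cls g T a, S.cls_mem_filt g T n ha⟩ := by
  have h : (LinearEquiv.ofBijective (DirectSum.coeLinearMap S.weightSpace) S.bijective_coeLinearMap).symm a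
      = DirectSum.lof ℂ ℤ (fun n => S.weightSpace n) (n : ℤ) ⟨a, ha⟩ := by
    rw [LinearEquiv.symm_apply_eq]
    simp
  simp only [grMap, LinearMap.comp_apply, LinearEquiv.coe_coe, h, DirectSum.toModule_lof]
  rfl

/-- The bilinear product `μ` on `X` is associative with two-sided identity `e`. -/
structure IsAssocAlg {X : Type*} [AddCommMonoid X] [Module ℂ X]
    (μ : X →ₗ[ℂ] X →ₗ[ℂ] X) (e : X) : Prop where
  assoc : ∀ x y z : X, μ (μ x y) z = μ x (μ y z)
  one_mul : ∀ x : X, μ e x = x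
  mul_one : ∀ x : X, μ x e = x

/-- The bilinear product `μ` on `X` is commutative and associative with identity `e`. -/
structure IsCommAssocAlg {X : Type*} [AddCommMonoid X] [Module ℂ X]
    (μ : X →ₗ[ℂ] X →ₗ[ℂ] X) (e : X) : Prop extends IsAssocAlg μ e where
  comm : ∀ x y : X, μ x y = μ y x

/-- `μG` is the product of `gr A_g(V)` induced by the product `μ` of `A_g(V)`: the latter satisfies
`A_g(V)_m A_g(V)_n ⊆ A_g(V)_(m+n)` and
`(x + A_g(V)_(m-1)) (y + A_g(V)_(n-1)) = x y + A_g(V)_(m+n-1)`. -/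
def IsGrProduct (g : V ≃ₗ[ℂ] V) (T : ℕ) (μ : S.Ag g T →ₗ[ℂ] S.Ag g T →ₗ[ℂ] S.Ag g T)
    (μG : S.Gr g T →ₗ[ℂ] S.Gr g T →ₗ[ℂ] S.Gr g T) : Prop :=
  ∀ (m n : ℕ) (x : S.filt g T m) (y : S.filt g T n),
    ∃ h : μ x y ∈ S.filt g T ((m + n : ℕ) : ℤ),
      μG (S.symb g T m x) (S.symb g T n y) = S.symb g T (m + n) ⟨μ x y, h⟩

end VertexOperatorAlgebra

end

/-! Everything rests on leading terms. For a, b of weights m, n the mode `a_(k+j) b` has weight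
m+n-k-j-1, so Res (1+z)^α z^k Y(a,z)b is `a_k b` plus terms of smaller weight, whatever α is
(`res_sub_mode_mem_weightLE`). With k = -2, the elements of `Og` show that the class of `a_(-2) b`
lies one filtration step below its weight, so `C2` dies in the graded algebra. With k = -1, the Zhu
product has symbol `a_(-1) b`; for a in V^r, r ≠ 0, both sides vanish in the graded piece because
Res (1+z)^(m-1+r/T) z⁻¹ Y(a,z)b lies in `Og`. The induced map is therefore multiplicative. It is
onto since filtration pieces are spanned by classes of homogeneous vectors, so the graded algebra
inherits commutativity and associativity from R(V).

The longer task is that the products exist. On A_g(V), left multiplication is Res (1+z)^m z⁻¹ Y(a,z)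
and right multiplication is Res (1+z)^(m-1) z⁻¹ Y(a,z), for a in V^0. By `res_commutator_mem`,
commutators of such operators are residues of the fields of `a_s b` with deeper poles. The weight of
`a_s b` matches the exponent, so they land in `Og`. Hence the operators preserve `Og` and commute
modulo it, and `exists_quotient_product` turns this into an associative product. The same criterion
with `a_(-1)` on both sides gives R(V). -/

noncomputable section

namespace VertexOperatorAlgebra

/-! ### Residues of fields against power series, and their commutators -/

section

open PowerSeries Finset

variable {V : Type*} [AddCommGroup V] [Module ℂ V] (S : VertexOperatorAlgebra V)

/-- A double sum against a sequence vanishing from `M` on is the sum against the Cauchy product. -/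
theorem sum_coeff_mul_smul (f h : ℂ⟦X⟧) (v : ℕ → V) (M : ℕ) (hv : ∀ n, M ≤ n → v n = 0) :
    ∑ n ∈ range M, coeff n (f * h) • v n
      = ∑ p ∈ range M, ∑ q ∈ range M, (coeff p f * coeff q h) • v (p + q) := by
  have h1 : ∀ p ∈ range M, ∑ q ∈ range M, (coeff p f * coeff q h) • v (p + q)
      = ∑ q ∈ range (M - p), (coeff p f * coeff q h) • v (p + q) := by
    intro p hp
    refine (sum_subset (range_mono (Nat.sub_le _ _)) fun q _ hq => ?_).symm
    rw [hv _ (by simp at hq; omega), smul_zero]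
  rw [sum_congr rfl h1, ← sum_range_diag_flip M fun p q => (coeff p f * coeff q h) • v (p + q)]
  refine sum_congr rfl fun n _ => ?_
  rw [coeff_mul, Finset.Nat.sum_antidiagonal_eq_sum_range_succ_mk, sum_smul]
  refine sum_congr rfl fun p hp => ?_
  rw [Nat.add_sub_cancel' (by simp at hp; omega)]

theorem mode_add_left (a b c : V) (n : ℤ) : S.mode (a + b) n c = S.mode a n c + S.mode b n c := by
  simp [mode]

theorem mode_smul_left (x : ℂ) (a c : V) (n : ℤ) : S.mode (x • a) n c = x • S.mode a n c := by
  simp [mode]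

theorem smear_finite_support (f : ℂ⟦X⟧) (k : ℤ) (a b : V) :
    (Function.support fun j : ℕ => coeff j f • S.mode a (j + k) b).Finite := by
  obtain ⟨N, hN⟩ := S.exists_mode_eq_zero a b
  refine (Set.finite_lt_nat (N - k).toNat).subset fun j hj => ?_
  by_contra h
  refine hj ?_
  have : N ≤ (j : ℤ) + k := by
    simp only [Set.mem_ofPred_eq, not_lt] at h
    omega
  simp [hN _ this]

/-- `Res_z f(z) z^k Y(a,z) b`, for a power series `f`. -/
def smear (f : ℂ⟦X⟧) (k : ℤ) : V →ₗ[ℂ] V →ₗ[ℂ] V :=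
  LinearMap.mk₂ ℂ (fun a b => ∑ᶠ j : ℕ, coeff j f • S.mode a (j + k) b)
    (fun a a' b => by
      rw [← finsum_add_distrib (S.smear_finite_support f k a b) (S.smear_finite_support f k a' b)]
      simp [mode_add_left])
    (fun x a b => by
      rw [smul_finsum]
      simp [mode_smul_left, smul_comm x])
    (fun a b b' => by
      rw [← finsum_add_distrib (S.smear_finite_support f k a b) (S.smear_finite_support f k a b')]
      simp)
    (fun x a b => by
      rw [smul_finsum]
      simp [smul_comm x])

theorem smear_apply (f : ℂ⟦X⟧) (k : ℤ) (a b : V) :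
    S.smear f k a b = ∑ᶠ j : ℕ, coeff j f • S.mode a (j + k) b := rfl

theorem res_eq_smear (α : ℂ) (k : ℤ) (a b : V) :
    S.res α k a b = S.smear (PowerSeries.binomialSeries ℂ α) k a b := by
  simp [res, smear_apply]

theorem smear_eq_sum (f : ℂ⟦X⟧) (k : ℤ) (a b : V) {N : ℤ} (hN : ∀ n, N ≤ n → S.mode a n b = 0)
    {M : ℕ} (hM : N ≤ M + k) :
    S.smear f k a b = ∑ j ∈ range M, coeff j f • S.mode a (j + k) b := by
  rw [smear_apply]
  refine finsum_eq_sum_of_support_subset _ fun j hj => ?_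
  by_contra h
  refine hj ?_
  simp only [coe_range, Set.mem_Iio, not_lt] at h
  simp [hN (j + k) (by omega)]

theorem smear_one (k : ℤ) (a b : V) : S.smear 1 k a b = S.mode a k b := by
  rw [smear_apply, finsum_eq_single _ 0 fun j hj => by simp [coeff_one, hj]]
  simp

theorem smear_add (f h : ℂ⟦X⟧) (k : ℤ) (a b : V) :
    S.smear (f + h) k a b = S.smear f k a b + S.smear h k a b := by
  simp only [smear_apply]
  rw [← finsum_add_distrib (S.smear_finite_support f k a b) (S.smear_finite_support h k a b)]
  simp [add_smul]

theorem smear_smul (x : ℂ) (f : ℂ⟦X⟧) (k : ℤ) (a b : V) :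
    S.smear (x • f) k a b = x • S.smear f k a b := by
  simp only [smear_apply]
  rw [smul_finsum]
  simp [mul_smul]

theorem smear_zero (k : ℤ) (a b : V) : S.smear 0 k a b = 0 := by
  simpa using S.smear_smul 0 0 k a b

theorem smear_sum {ι : Type*} (s : Finset ι) (f : ι → ℂ⟦X⟧) (k : ℤ) (a b : V) :
    S.smear (∑ i ∈ s, f i) k a b = ∑ i ∈ s, S.smear (f i) k a b := by
  classical
  induction s using Finset.induction_on with
  | empty => simp [smear_zero]
  | insert i s hi ih => rw [sum_insert hi, sum_insert hi, smear_add, ih]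

theorem smear_mul_X (f : ℂ⟦X⟧) (k : ℤ) (a b : V) :
    S.smear (f * X) k a b = S.smear f (k + 1) a b := by
  obtain ⟨N, hN⟩ := S.exists_mode_eq_zero a b
  have h1 : N ≤ ((N - k).toNat : ℕ) + (k + 1) := by omega
  rw [S.smear_eq_sum f (k + 1) a b hN h1,
    S.smear_eq_sum (f * X) k a b hN (M := (N - k).toNat + 1) (by push_cast; omega), sum_range_succ']
  simp only [coeff_succ_mul_X, coeff_zero_mul_X, zero_smul, add_zero]
  refine sum_congr rfl fun j _ => ?_
  rw [Nat.cast_add_one, add_assoc, add_comm 1 k]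

theorem smear_mul_X_pow (f : ℂ⟦X⟧) (t : ℕ) (k : ℤ) (a b : V) :
    S.smear (f * X ^ t) k a b = S.smear f (k + t) a b := by
  induction t generalizing f k with
  | zero => simp
  | succ t ih =>
    rw [pow_succ', ← mul_assoc, ih, smear_mul_X]
    push_cast
    rw [add_assoc]

/-- This is the Jacobi identity at l = 0, where only the i = 0 term survives on the left. -/
theorem mode_commutator (a b c : V) (m n : ℤ) {N : ℕ} (hN : ∀ n : ℤ, N ≤ n → S.mode a n b = 0) :
    S.mode a m (S.mode b n c) - S.mode b n (S.mode a m c)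
      = ∑ s ∈ range N, ((Ring.choose m s : ℤ) : ℂ) • S.mode (S.mode a s b) (m + n - s) c := by
  have h := S.jacobi a b c 0 m n
  rw [finsum_eq_single _ 0 fun i hi => by
    rw [Ring.choose_zero_pos _ (Nat.pos_of_ne_zero hi)]; simp] at h
  simp only [pow_zero, Ring.choose_zero_right, mul_one, one_smul, add_zero, Nat.cast_zero, sub_zero,
    Int.negOnePow_zero, zero_add] at h
  change S.mode a m (S.mode b n c) - S.mode b n (S.mode a m c)
    = ∑ᶠ j : ℕ, Ring.choose m j • S.mode (S.mode a j b) (m + n - j) c at h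
  rw [h, finsum_eq_sum_of_support_subset (s := range N)]
  · refine sum_congr rfl fun s _ => ?_
    rw [← Int.cast_smul_eq_zsmul ℂ]
  · intro j hj
    by_contra h'
    refine hj ?_
    simp only [coe_range, Set.mem_Iio, not_lt] at h'
    have h0 := hN j (by exact_mod_cast h')
    simp only [h0]
    simp [mode]

/-- The power series `h` with `h z^(k-s) = (1/s!) (d/dz)^s (f z^k)`. -/
def hasse (s : ℕ) (k : ℤ) (f : ℂ⟦X⟧) : ℂ⟦X⟧ :=
  PowerSeries.mk fun i => ((Ring.choose ((i : ℤ) + k) s : ℤ) : ℂ) * coeff i f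

/-- Only finitely many `u q` are nonzero, so their truncation bounds have a common maximum. -/
theorem exists_forall_mode_eq_zero (a : V) (u : ℕ → V) (M : ℕ) (hu : ∀ q, M ≤ q → u q = 0) :
    ∃ N : ℤ, ∀ q : ℕ, ∀ n : ℤ, N ≤ n → S.mode a n (u q) = 0 := by
  choose N hN using fun q => S.exists_mode_eq_zero a (u q)
  obtain ⟨N', hN'⟩ := ((range M).image N).exists_le
  refine ⟨N', fun q n hn => ?_⟩
  by_cases hq : q < M
  · exact hN q n ((hN' _ (mem_image_of_mem N (mem_range.2 hq))).trans hn)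
  · rw [hu q (not_lt.1 hq), map_zero]

/-- Every large enough square cutoff works, so the two orders of composition can be compared on one
square. -/
theorem exists_smear_smear_eq_sum (f h : ℂ⟦X⟧) (k l : ℤ) (a b c : V) :
    ∃ M₀ : ℕ, ∀ M, M₀ ≤ M → S.smear f k a (S.smear h l b c) =
      ∑ p ∈ range M, ∑ q ∈ range M,
        (coeff p f * coeff q h) • S.mode a (p + k) (S.mode b (q + l) c) := by
  obtain ⟨N, hN⟩ := S.exists_mode_eq_zero b c
  obtain ⟨N', hN'⟩ := S.exists_forall_mode_eq_zero a (fun q : ℕ => S.mode b (q + l) c)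
    (N - l).toNat fun q hq => hN _ (by omega)
  refine ⟨max (N - l).toNat (N' - k).toNat, fun M hM => ?_⟩
  rw [S.smear_eq_sum h l b c hN (M := M) (by omega), map_sum, sum_comm]
  refine sum_congr rfl fun q _ => ?_
  rw [map_smul, S.smear_eq_sum f k a _ (hN' q) (M := M) (by omega), smul_sum]
  refine sum_congr rfl fun p _ => ?_
  rw [smul_smul, mul_comm]

/-- Sum the mode commutators against the coefficients of f and h: the factor `choose (p + k) s`
turns f z^k into its s-th divided derivative. -/
theorem smear_commutator (f h : ℂ⟦X⟧) (k l : ℤ) (a b c : V) {N : ℕ}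
    (hN : ∀ n : ℤ, N ≤ n → S.mode a n b = 0) :
    S.smear f k a (S.smear h l b c) - S.smear h l b (S.smear f k a c)
      = ∑ s ∈ range N, S.smear (hasse s k f * h) (k + l - s) (S.mode a s b) c := by
  obtain ⟨M₁, h₁⟩ := S.exists_smear_smear_eq_sum f h k l a b c
  obtain ⟨M₂, h₂⟩ := S.exists_smear_smear_eq_sum h f l k b a c
  choose E hE using fun s : ℕ => S.exists_mode_eq_zero (S.mode a s b) c
  obtain ⟨E', hE'⟩ := ((range N).image E).exists_le
  -- E' truncates all fields of `a_s b` on c for s < N; the extra N absorbs the shift of the mode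
  -- index by -s.
  obtain ⟨M, hM⟩ : ∃ M : ℕ, M₁ ≤ M ∧ M₂ ≤ M ∧ E' - k - l + N ≤ M :=
    ⟨max (max M₁ M₂) (E' - k - l + N).toNat, by omega, by omega, by omega⟩
  have h₃ : ∀ s ∈ range N, S.smear (hasse s k f * h) (k + l - s) (S.mode a s b) c
      = ∑ p ∈ range M, ∑ q ∈ range M, (coeff p f * coeff q h) •
          ((Ring.choose ((p : ℤ) + k) s : ℤ) : ℂ) •
            S.mode (S.mode a s b) ((p + k) + (q + l) - s) c := by
    intro s hs
    have hs' : E s ≤ E' := hE' _ (mem_image_of_mem E hs)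
    have hsN : s < N := mem_range.1 hs
    rw [S.smear_eq_sum _ _ _ _ (hE s) (M := M) (by omega),
      sum_coeff_mul_smul _ _ (fun n : ℕ => S.mode (S.mode a s b) (n + (k + l - s)) c) M
        fun n hn => hE s _ (by omega)]
    refine sum_congr rfl fun p _ => sum_congr rfl fun q _ => ?_
    rw [smul_smul, hasse, coeff_mk]
    congr 1
    · ring
    · congr 2
      push_cast
      ring
  rw [h₁ M hM.1, h₂ M hM.2.1, sum_congr rfl h₃]
  conv_lhs => arg 2; rw [sum_comm]
  conv_rhs => rw [sum_comm]
  rw [← sum_sub_distrib]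
  refine sum_congr rfl fun p _ => ?_
  rw [← sum_sub_distrib]
  conv_rhs => rw [sum_comm]
  refine sum_congr rfl fun q _ => ?_
  rw [← smul_sum, ← S.mode_commutator a b c _ _ hN, smul_sub, mul_comm (coeff q h)]

end

/-! ### Divided derivatives of (1+z)^α z⁻¹ and integration by parts -/

section

open PowerSeries Finset

theorem succ_mul_choose_succ (r : ℂ) (n : ℕ) :
    ((n : ℂ) + 1) * Ring.choose r (n + 1) = r * Ring.choose (r - 1) n := by
  have h := Ring.choose_smul_choose r (n := n + 1) (k := 1) (by omega)
  simpa using h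

theorem succ_mul_choose_succ_int (r : ℤ) (s : ℕ) :
    ((s : ℤ) + 1) * Ring.choose r (s + 1) = (r - s) * Ring.choose r s := by
  have h := Ring.choose_smul_choose r (n := s + 1) (k := s) (by omega)
  simp at h
  rw [h, mul_comm]

theorem derivative_binomialSeries (β : ℂ) :
    PowerSeries.derivative ℂ (PowerSeries.binomialSeries ℂ β) = β • PowerSeries.binomialSeries ℂ (β - 1) := by
  ext n
  have := succ_mul_choose_succ β n
  simp [coeff_derivative]
  rw [mul_comm, this]

theorem binomialSeries_eq_mul_one_add_X (β : ℂ) :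
    PowerSeries.binomialSeries ℂ β = PowerSeries.binomialSeries ℂ (β - 1) * (1 + X) := by
  have h := binomialSeries_add (A := ℂ) (β - 1) ((1 : ℕ) : ℂ)
  rw [binomialSeries_nat, pow_one] at h
  rw [← h]
  simp

theorem hasse_zero (k : ℤ) (f : ℂ⟦X⟧) : hasse 0 k f = f := by
  ext i
  simp [hasse]

/-- Differentiating h z^(k-s) gives (z h' + (k-s) h) z^(k-s-1). -/
theorem smul_hasse_succ (s : ℕ) (k : ℤ) (f : ℂ⟦X⟧) :
    ((s : ℂ) + 1) • hasse (s + 1) k f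
      = X * PowerSeries.derivative ℂ (hasse s k f) + ((k : ℂ) - s) • hasse s k f := by
  ext i
  have h := succ_mul_choose_succ_int (i + k) s
  apply_fun ((↑) : ℤ → ℂ) at h
  push_cast at h
  have hX : coeff i (X * PowerSeries.derivative ℂ (hasse s k f)) = i * coeff i (hasse s k f) := by
    cases i with
    | zero => simp
    | succ i => rw [coeff_succ_X_mul, coeff_derivative]; push_cast; ring
  rw [map_add, hX]
  simp only [hasse, coeff_smul, coeff_mk, smul_eq_mul]
  linear_combination (coeff i f) * h

open Polynomial in
theorem natDegree_hasse_step (s : ℕ) (β : ℂ) (P : ℂ[X]) (hP : P.natDegree ≤ s) :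
    (Polynomial.C β * Polynomial.X * P + (1 + Polynomial.X) * (Polynomial.X * Polynomial.derivative P
      - Polynomial.C ((s : ℂ) + 1) * P)).natDegree ≤ s + 1 := by
  have h1 : (Polynomial.X * Polynomial.derivative P).natDegree ≤ s := by
    rw [Polynomial.natDegree_le_iff_coeff_eq_zero] at hP ⊢
    intro N hN
    obtain ⟨N, rfl⟩ : ∃ M, N = M + 1 := ⟨N - 1, by omega⟩
    rw [Polynomial.coeff_X_mul, Polynomial.coeff_derivative, hP _ hN, zero_mul]
  have h2 : (Polynomial.C ((s : ℂ) + 1) * P).natDegree ≤ s :=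
    (Polynomial.natDegree_C_mul_le _ _).trans hP
  have h3 : (1 + Polynomial.X : ℂ[X]).natDegree ≤ 1 :=
    (Polynomial.natDegree_add_le _ _).trans (by simp)
  refine (Polynomial.natDegree_add_le _ _).trans (max_le ?_ ?_)
  · rw [mul_assoc]
    refine (Polynomial.natDegree_C_mul_le _ _).trans (Polynomial.natDegree_mul_le.trans ?_)
    rw [Polynomial.natDegree_X]
    omega
  · refine Polynomial.natDegree_mul_le.trans ?_
    have := (Polynomial.natDegree_sub_le _ _).trans (max_le h1 h2)
    omega

/-- `(1/s!) (d/dz)^s ((1+z)^α z⁻¹)` is `(1+z)^(α-s)` times a combination of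
`z⁻¹, …, z^(-1-s)`. -/
theorem exists_hasse_binomialSeries (α : ℂ) (s : ℕ) :
    ∃ P : Polynomial ℂ, P.natDegree ≤ s ∧
      hasse s (-1) (PowerSeries.binomialSeries ℂ α) = PowerSeries.binomialSeries ℂ (α - s) * (P : ℂ⟦X⟧) := by
  induction s with
  | zero => exact ⟨1, by simp, by simp [hasse_zero]⟩
  | succ s ih =>
    obtain ⟨P, hP, h⟩ := ih
    -- Apply the recursion to (1+z)^(α-s) P with k = -1 and extract the factor (1+z)^(α-s-1); the
    -- other factor is this polynomial.
    refine ⟨Polynomial.C ((s : ℂ) + 1)⁻¹ * (Polynomial.C (α - s) * Polynomial.X * P +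
      (1 + Polynomial.X) * (Polynomial.X * Polynomial.derivative P
        - Polynomial.C ((s : ℂ) + 1) * P)), ?_, ?_⟩
    · exact (Polynomial.natDegree_C_mul_le _ _).trans (natDegree_hasse_step s _ P hP)
    · have hs : (s : ℂ) + 1 ≠ 0 := Nat.cast_add_one_ne_zero s
      have h' := smul_hasse_succ s (-1) (PowerSeries.binomialSeries ℂ α)
      rw [← inv_smul_smul₀ hs (hasse (s + 1) (-1) (PowerSeries.binomialSeries ℂ α)), h', h, Derivation.leibniz,
        derivative_binomialSeries, derivative_coe]
      have hb := binomialSeries_eq_mul_one_add_X (α - s)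
      rw [show α - ((s + 1 : ℕ) : ℂ) = α - s - 1 by push_cast; ring]
      push_cast
      simp only [smul_eq_mul, smul_eq_C_mul]
      rw [hb]
      simp only [map_add, map_sub, map_neg, map_one]
      ring

variable {V : Type*} [AddCommGroup V] [Module ℂ V] (S : VertexOperatorAlgebra V)

theorem smear_binomialSeries_mul (γ : ℂ) (P : Polynomial ℂ) (s : ℕ) (hP : P.natDegree ≤ s) (k : ℤ)
    (a b : V) : S.smear (PowerSeries.binomialSeries ℂ γ * (P : ℂ⟦X⟧)) k a b
      = ∑ t ∈ range (s + 1), P.coeff t • S.res γ (k + t) a b := by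
  have h : (P : ℂ⟦X⟧) = ∑ t ∈ range (s + 1), P.coeff t • X ^ t := by
    conv_lhs => rw [P.as_sum_range_C_mul_X_pow' (Nat.lt_succ_of_le hP)]
    rw [← Polynomial.coeToPowerSeries.ringHom_apply, map_sum]
    simp [smul_eq_C_mul]
  rw [h, mul_sum, smear_sum]
  refine sum_congr rfl fun t _ => ?_
  rw [mul_smul_comm, smear_smul, smear_mul_X_pow, res_eq_smear]

/-- The commutator of `Res_z (1+z)^α z⁻¹ Y(a,z)` and `Res_z (1+z)^β z^l Y(b,z)` is a combination of
the operators `Res_z (1+z)^(α+β-s) z^(l-1-t) Y(a_s b,z)`. -/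
theorem res_commutator_mem (U : Submodule ℂ V) (α β : ℂ) (l : ℤ) (a b c : V)
    (h : ∀ s t : ℕ, S.res (α + β - s) (l - 1 - t) (S.mode a s b) c ∈ U) :
    S.res α (-1) a (S.res β l b c) - S.res β l b (S.res α (-1) a c) ∈ U := by
  obtain ⟨N, hN⟩ := S.exists_mode_eq_zero a b
  simp only [res_eq_smear _ α, res_eq_smear _ β]
  rw [S.smear_commutator _ _ _ _ a b c (N := N.toNat) fun n hn => hN n (by omega)]
  refine U.sum_mem fun s _ => ?_
  obtain ⟨P, hP, hs⟩ := exists_hasse_binomialSeries α s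
  rw [hs, mul_right_comm, ← binomialSeries_add, smear_binomialSeries_mul _ _ _ s hP]
  refine U.sum_mem fun t ht => U.smul_mem _ ?_
  -- The monomial z^t of P reduces the pole, so it corresponds to the index s - t of the hypothesis.
  have := h s (s - t)
  rw [mem_range] at ht
  rw [show α - s + β = α + β - s by ring, show -1 + l - (s : ℤ) + t = l - 1 - ((s - t : ℕ) : ℤ) by
    omega]
  exact this

theorem res_succ (α : ℂ) (k : ℤ) (a b : V) :
    S.res (α + 1) k a b = S.res α k a b + S.res α (k + 1) a b := by
  simp only [res_eq_smear]
  rw [binomialSeries_eq_mul_one_add_X, mul_add, mul_one, smear_add, smear_mul_X]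
  simp

/-- Integration by parts, with d/dz ((1+z)^(α+1) z^k) = (1+z)^α (k z^(k-1) + (k+α+1) z^k). -/
theorem res_derivative (α : ℂ) (k : ℤ) (a b : V) :
    S.res (α + 1) k (S.mode S.omega 0 a) b
      = (-(k : ℂ)) • S.res α (k - 1) a b - (k + α + 1 : ℂ) • S.res α k a b := by
  have hm : ∀ n : ℤ, S.mode (S.mode S.omega 0 a) n b = (-(n : ℂ)) • S.mode a (n - 1) b :=
    fun n => S.derivative a b n
  simp only [res_eq_smear]
  have h1 : S.smear (PowerSeries.binomialSeries ℂ (α + 1)) k (S.mode S.omega 0 a) b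
      = S.smear (PowerSeries.mk fun j => (-((j : ℂ) + k)) * Ring.choose (α + 1) j) (k - 1) a b := by
    simp only [smear_apply]
    refine finsum_congr fun j => ?_
    rw [hm, smul_smul, coeff_mk, binomialSeries_coeff, add_sub_assoc]
    congr 1
    push_cast
    simp
    ring
  have h2 : (PowerSeries.mk fun j => (-((j : ℂ) + k)) * Ring.choose (α + 1) j)
      = (-(k : ℂ)) • PowerSeries.binomialSeries ℂ α + (-(k + α + 1 : ℂ)) • (PowerSeries.binomialSeries ℂ α * X) := by
    ext j
    cases j with
    | zero => simp
    | succ j =>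
      have e1 := succ_mul_choose_succ (α + 1) j
      have e2 := Ring.choose_succ_succ α j
      rw [add_sub_cancel_right] at e1
      simp only [coeff_mk, map_add, coeff_smul, coeff_succ_mul_X, binomialSeries_coeff, smul_eq_mul,
        mul_one]
      push_cast
      linear_combination (-1 : ℂ) * e1 - k * e2
  rw [h1, h2, smear_add, smear_smul, smear_smul, smear_mul_X, sub_add_cancel,
    neg_smul (k + α + 1 : ℂ), ← sub_eq_add_neg]

end

/-! ### Weights and leading terms -/

section

open PowerSeries Finset

variable {V : Type*} [AddCommGroup V] [Module ℂ V] (S : VertexOperatorAlgebra V)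

theorem mem_weightSpace_iff {n : ℤ} {a : V} :
    a ∈ S.weightSpace n ↔ S.mode S.omega 1 a = (n : ℂ) • a := by
  rw [weightSpace, Module.End.mem_eigenspace_iff]

/-- The commutator of L(0) with `a_p` is (L(-1)a)_(p+1) + (L(0)a)_p, because `choose 1 s` vanishes
for s ≥ 2; the derivative axiom evaluates the first term. -/
theorem mode_mem_weightSpace {m n : ℤ} {a b : V} (ha : a ∈ S.weightSpace m)
    (hb : b ∈ S.weightSpace n) (p : ℤ) : S.mode a p b ∈ S.weightSpace (m + n - p - 1) := by
  rw [mem_weightSpace_iff] at *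
  obtain ⟨N, hN⟩ := S.exists_mode_eq_zero S.omega a
  have h := S.mode_commutator S.omega a b 1 p (N := N.toNat + 2) fun n hn => hN n (by omega)
  have hz : ∀ s : ℕ, Ring.choose (1 : ℤ) (s + 2) = 0 := fun s => by
    have := Ring.choose_natCast (R := ℤ) 1 (s + 2)
    rw [Nat.choose_eq_zero_of_lt (by omega)] at this
    simpa using this
  have hd : S.mode (S.mode S.omega 0 a) (1 + p) b = (-((1 + p : ℤ) : ℂ)) • S.mode a (1 + p - 1) b :=
    S.derivative a b (1 + p)
  rw [sum_range_succ', sum_range_succ', sum_eq_zero fun s _ => by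
    rw [add_assoc, one_add_one_eq_two, hz]; simp] at h
  simp only [Ring.choose_one_right, Ring.choose_zero_right, zero_add, Nat.cast_one, Nat.cast_zero,
    Int.cast_one, one_smul, hb, ha, sub_zero, map_smul, mode_smul_left, hd, add_sub_cancel_left]
    at h
  rw [sub_eq_iff_eq_add.1 h]
  push_cast
  module

/-- `⊕_{0 ≤ i ≤ n} V_i`. -/
def weightLE (n : ℤ) : Submodule ℂ V := ⨆ (i : ℕ) (_ : (i : ℤ) ≤ n), S.weightSpace i

theorem weightLE_le_iff {n : ℤ} {U : Submodule ℂ V} :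
    S.weightLE n ≤ U ↔ ∀ i : ℕ, (i : ℤ) ≤ n → S.weightSpace i ≤ U := iSup₂_le_iff

variable {S} in
theorem IsCFTType.weightSpace_le_weightLE (hV : S.IsCFTType) {m n : ℤ} (h : m ≤ n) :
    S.weightSpace m ≤ S.weightLE n := by
  rcases lt_or_ge m 0 with hm | hm
  · rw [hV.nonneg m hm]
    exact bot_le
  · lift m to ℕ using hm
    exact le_iSup₂_of_le m h le_rfl

theorem weightLE_mono {m n : ℤ} (h : m ≤ n) : S.weightLE m ≤ S.weightLE n :=
  S.weightLE_le_iff.2 fun i hi => le_iSup₂_of_le i (hi.trans h) le_rfl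

theorem iSup_weightSpace : ⨆ n : ℤ, S.weightSpace n = ⊤ :=
  DirectSum.IsInternal.submodule_iSup_eq_top S.grading

variable {S} in
theorem IsCFTType.iSup_weightSpace_nat (hV : S.IsCFTType) : ⨆ n : ℕ, S.weightSpace n = ⊤ := by
  rw [eq_top_iff, ← S.iSup_weightSpace]
  refine iSup_le fun n => ?_
  rcases lt_or_ge n 0 with hn | hn
  · rw [hV.nonneg n hn]
    exact bot_le
  · lift n to ℕ using hn
    exact le_iSup (fun n : ℕ => S.weightSpace n) n

section Leading

variable {S} (hV : S.IsCFTType) {m n : ℤ} {a b : V} (ha : a ∈ S.weightSpace m)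
  (hb : b ∈ S.weightSpace n) (α : ℂ) (k : ℤ)
include hV ha hb

theorem IsCFTType.mode_mem_weightLE {p d : ℤ} (h : m + n - p - 1 ≤ d) :
    S.mode a p b ∈ S.weightLE d :=
  hV.weightSpace_le_weightLE h (S.mode_mem_weightSpace ha hb p)

theorem IsCFTType.res_sub_mode_mem_weightLE {d : ℤ} (h : m + n - k - 2 ≤ d) :
    S.res α k a b - S.mode a k b ∈ S.weightLE d := by
  obtain ⟨N, hN⟩ := S.exists_mode_eq_zero a b
  rw [res_eq_smear, S.smear_eq_sum _ k a b hN (M := (N - k).toNat + 1) (by omega), sum_range_succ']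
  simp only [binomialSeries_coeff, Ring.choose_zero_right, one_smul, Nat.cast_zero, zero_add,
    add_sub_cancel_right]
  exact Submodule.sum_mem _ fun j _ => Submodule.smul_mem _ _
    (hV.mode_mem_weightLE ha hb (by push_cast; omega))

end Leading

/-! ### Eigenspace decomposition under the automorphism -/

/-- `e^(2πi r/T)` -/
def root (T r : ℕ) : ℂ := Complex.exp (2 * Real.pi * Complex.I * (r / T))

theorem mem_eigen_iff {g : V ≃ₗ[ℂ] V} {T r : ℕ} {a : V} :
    a ∈ eigen g T r ↔ g a = root T r • a := by
  rw [eigen, Module.End.mem_eigenspace_iff]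
  rfl

theorem root_zero (T : ℕ) : root T 0 = 1 := by simp [root]

theorem mem_eigen_zero_iff {g : V ≃ₗ[ℂ] V} {T : ℕ} {a : V} : a ∈ eigen g T 0 ↔ g a = a := by
  rw [mem_eigen_iff, root_zero, one_smul]

theorem root_eq_pow (T r : ℕ) : root T r = root T 1 ^ r := by
  rw [root, root, ← Complex.exp_nat_mul]
  congr 1
  push_cast
  ring

theorem isPrimitiveRoot_root_one {T : ℕ} (hT : 0 < T) : IsPrimitiveRoot (root T 1) T := by
  have := Complex.isPrimitiveRoot_exp T hT.ne'
  rw [root]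
  convert this using 2
  push_cast
  ring

theorem root_ne_zero (T r : ℕ) : root T r ≠ 0 := Complex.exp_ne_zero _

theorem root_pow {T : ℕ} (hT : 0 < T) (r : ℕ) : root T r ^ T = 1 := by
  rw [root_eq_pow, pow_right_comm, (isPrimitiveRoot_root_one hT).pow_eq_one, one_pow]

theorem root_ne_one {T r : ℕ} (hr : 0 < r) (hrT : r < T) : root T r ≠ 1 := by
  rw [root_eq_pow]
  exact (isPrimitiveRoot_root_one (hr.trans hrT)).pow_ne_one_of_pos_of_lt hr.ne' hrT

theorem geom_sum_eq_zero_of_pow_eq_one {x : ℂ} {T : ℕ} (hx : x ^ T = 1) (h : x ≠ 1) :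
    ∑ k ∈ range T, x ^ k = 0 := by
  rw [geom_sum_eq h, hx, sub_self, zero_div]

/-- The projection of `V` onto the eigenspace `V^r`. -/
def proj (g : V ≃ₗ[ℂ] V) (T r : ℕ) : V →ₗ[ℂ] V :=
  (T : ℂ)⁻¹ • ∑ k ∈ range T, ((root T r)⁻¹ ^ k) • (g : V →ₗ[ℂ] V) ^ k

theorem proj_apply (g : V ≃ₗ[ℂ] V) (T r : ℕ) (a : V) :
    proj g T r a = (T : ℂ)⁻¹ • ∑ k ∈ range T, ((root T r)⁻¹ ^ k) • ((g : V →ₗ[ℂ] V) ^ k) a := by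
  simp [proj, LinearMap.sum_apply]

theorem pow_toLinearMap_eq_one {g : V ≃ₗ[ℂ] V} {T : ℕ} (hg : g ^ T = 1) :
    (g : V →ₗ[ℂ] V) ^ T = 1 := by
  have h : ∀ (n : ℕ) (a : V), ((g : V →ₗ[ℂ] V) ^ n) a = (g ^ n) a := by
    intro n
    induction n with
    | zero => simp
    | succ n ih => intro a; rw [pow_succ', pow_succ', Module.End.mul_apply, ih]; rfl
  ext a
  rw [h, hg]
  rfl

/-- Applying g shifts the sum cyclically; it closes up because g and the root both have T-th power
1. -/
theorem proj_mem_eigen {g : V ≃ₗ[ℂ] V} {T : ℕ} (hT : 0 < T) (hg : g ^ T = 1) (r : ℕ) (a : V) :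
    proj g T r a ∈ eigen g T r := by
  rw [mem_eigen_iff, proj_apply, map_smul, smul_comm, map_sum]
  congr 1
  have h1 : ∀ k ∈ range T, g (((root T r)⁻¹ ^ k) • ((g : V →ₗ[ℂ] V) ^ k) a)
      = root T r • ((root T r)⁻¹ ^ (k + 1)) • ((g : V →ₗ[ℂ] V) ^ (k + 1)) a := by
    intro k _
    rw [map_smul, smul_smul, pow_succ' (root T r)⁻¹, mul_inv_cancel_left₀ (root_ne_zero T r),
      pow_succ', Module.End.mul_apply]
    rfl
  rw [sum_congr rfl h1, ← smul_sum]
  congr 1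
  have h2 := sum_range_succ' (fun k => ((root T r)⁻¹ ^ k) • ((g : V →ₗ[ℂ] V) ^ k) a) T
  rw [sum_range_succ, inv_pow _ T, root_pow hT, pow_toLinearMap_eq_one hg] at h2
  simpa using h2.symm

theorem sum_proj {g : V ≃ₗ[ℂ] V} {T : ℕ} (hT : 0 < T) (a : V) :
    ∑ r ∈ range T, proj g T r a = a := by
  have hT' : (T : ℂ) ≠ 0 := Nat.cast_ne_zero.2 hT.ne'
  simp only [proj_apply]
  rw [← smul_sum, sum_comm, sum_eq_single_of_mem 0 (mem_range.2 hT)]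
  · simp [← Nat.cast_smul_eq_nsmul ℂ, smul_smul, hT']
  · intro k hk hk0
    rw [← sum_smul]
    have : ∑ r ∈ range T, (root T r)⁻¹ ^ k = ∑ r ∈ range T, ((root T k)⁻¹) ^ r :=
      sum_congr rfl fun r _ => by
        rw [root_eq_pow T r, root_eq_pow T k, inv_pow, inv_pow, pow_right_comm]
    rw [this, geom_sum_eq_zero_of_pow_eq_one, zero_smul]
    · rw [inv_pow, root_pow hT, inv_one]
    · exact inv_ne_one.2 (root_ne_one (Nat.pos_of_ne_zero hk0) (mem_range.1 hk))

theorem proj_zero_of_apply_eq_smul {g : V ≃ₗ[ℂ] V} (T : ℕ) {x : ℂ} {a : V} (h : g a = x • a) :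
    proj g T 0 a = ((T : ℂ)⁻¹ * ∑ k ∈ range T, x ^ k) • a := by
  have hk : ∀ k : ℕ, ((g : V →ₗ[ℂ] V) ^ k) a = x ^ k • a := by
    intro k
    induction k with
    | zero => simp
    | succ k ih =>
      rw [pow_succ', Module.End.mul_apply, ih, map_smul, pow_succ, mul_smul, ← h]
      rfl
  simp [proj_apply, root_zero, hk, mul_smul, sum_smul]

theorem proj_zero_of_mem_eigen_zero {g : V ≃ₗ[ℂ] V} {T : ℕ} (hT : 0 < T) {a : V}
    (ha : a ∈ eigen g T 0) : proj g T 0 a = a := by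
  rw [mem_eigen_iff, root_zero] at ha
  have hT' : (T : ℂ) ≠ 0 := Nat.cast_ne_zero.2 hT.ne'
  rw [proj_zero_of_apply_eq_smul T ha]
  simp [hT']

theorem proj_zero_of_mem_eigen_pos {g : V ≃ₗ[ℂ] V} {T r : ℕ} (hr : 0 < r) (hrT : r < T) {a : V}
    (ha : a ∈ eigen g T r) : proj g T 0 a = 0 := by
  rw [proj_zero_of_apply_eq_smul T (mem_eigen_iff.1 ha),
    geom_sum_eq_zero_of_pow_eq_one (root_pow (hr.trans hrT) r) (root_ne_one hr hrT), mul_zero,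
    zero_smul]

variable {S}

theorem IsAutomorphism.proj_mem_weightSpace {g : V ≃ₗ[ℂ] V} (hg : S.IsAutomorphism g) (T r : ℕ)
    {n : ℤ} {a : V} (ha : a ∈ S.weightSpace n) : proj g T r a ∈ S.weightSpace n := by
  have h : ∀ b ∈ S.weightSpace n, g b ∈ S.weightSpace n := by
    intro b hb
    rw [mem_weightSpace_iff] at *
    have := hg.map_mode S.omega b 1
    rwa [hb, hg.map_omega, map_smul, eq_comm] at this
  have hk : ∀ k : ℕ, ((g : V →ₗ[ℂ] V) ^ k) a ∈ S.weightSpace n := by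
    intro k
    induction k with
    | zero => simpa
    | succ k ih =>
      rw [pow_succ', Module.End.mul_apply]
      exact h _ ih
  rw [proj_apply]
  exact Submodule.smul_mem _ _ (Submodule.sum_mem _ fun k _ => Submodule.smul_mem _ _ (hk k))

theorem IsAutomorphism.mode_mem_eigen {g : V ≃ₗ[ℂ] V} (hg : S.IsAutomorphism g) {T r : ℕ} {a b : V}
    (ha : a ∈ eigen g T 0) (hb : b ∈ eigen g T r) (n : ℤ) : S.mode a n b ∈ eigen g T r := by
  rw [mem_eigen_zero_iff] at ha
  rw [mem_eigen_iff] at *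
  rw [hg.map_mode, ha, hb, map_smul]

/-- The eigenprojections preserve weights, so a linear condition need only be tested on homogeneous
eigenvectors. -/
theorem IsAutomorphism.weightSpace_le {g : V ≃ₗ[ℂ] V} (hg : S.IsAutomorphism g) {T : ℕ}
    (hT : 0 < T) (hgT : g ^ T = 1) {n : ℤ} {U : Submodule ℂ V}
    (h : ∀ r < T, ∀ a ∈ eigen g T r, a ∈ S.weightSpace n → a ∈ U) : S.weightSpace n ≤ U := by
  intro a ha
  rw [← sum_proj (g := g) hT a]
  exact U.sum_mem fun r hr => h r (mem_range.1 hr) _ (proj_mem_eigen hT hgT r a)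
    (hg.proj_mem_weightSpace T r ha)

end

/-! ### Products on quotients: R(V) and A_g(V) -/

section

open PowerSeries Finset

variable {V : Type*} [AddCommGroup V] [Module ℂ V]

theorem exists_quotient_linear {X Z : Type*} [AddCommGroup X] [Module ℂ X] [AddCommMonoid Z]
    [Module ℂ Z] (p : Submodule ℂ X) (f : X →ₗ[ℂ] Z) (hp : ∀ x ∈ p, f x = 0) :
    ∃ φ : (X ⧸ p) →ₗ[ℂ] Z, ∀ x, φ (p.mkQ x) = f x := by
  -- Negation on Z is scalar multiplication by -1.
  let : AddCommGroup Z := Module.addCommMonoidToAddCommGroup ℂ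
  exact ⟨p.liftQ f hp, fun _ => rfl⟩

theorem exists_quotient_bilinear {X Y Z : Type*} [AddCommGroup X] [Module ℂ X] [AddCommGroup Y]
    [Module ℂ Y] [AddCommMonoid Z] [Module ℂ Z] (p : Submodule ℂ X) (q : Submodule ℂ Y)
    (f : X →ₗ[ℂ] Y →ₗ[ℂ] Z) (hp : ∀ x ∈ p, ∀ y, f x y = 0) (hq : ∀ x, ∀ y ∈ q, f x y = 0) :
    ∃ B : (X ⧸ p) →ₗ[ℂ] (Y ⧸ q) →ₗ[ℂ] Z, ∀ x y, B (p.mkQ x) (q.mkQ y) = f x y := by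
  obtain ⟨F, hF⟩ := exists_quotient_linear p f fun x hx => LinearMap.ext (hp x hx)
  obtain ⟨B, hB⟩ := exists_quotient_linear q F.flip fun y hy => LinearMap.ext fun x => by
    obtain ⟨x, rfl⟩ := p.mkQ_surjective x
    rw [LinearMap.flip_apply, hF]
    exact hq x y hy
  exact ⟨B.flip, fun x y => by rw [LinearMap.flip_apply, hB, LinearMap.flip_apply, hF]⟩

/-- If operators `L a` and `R b` preserve `O`, commute modulo `O` and satisfy `L a e ≡ a ≡ R a e`,
then `(a, b) ↦ L a b ≡ R b a` induces an associative product with identity on `V / O`. -/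
theorem exists_quotient_product (O : Submodule ℂ V) (L R : V →ₗ[ℂ] V →ₗ[ℂ] V) (e : V)
    (hL : ∀ a, ∀ x ∈ O, L a x ∈ O) (hR : ∀ a, ∀ x ∈ O, R a x ∈ O)
    (hLR : ∀ a b c, L a (R b c) - R b (L a c) ∈ O)
    (hLe : ∀ a, L a e - a ∈ O) (hRe : ∀ a, R a e - a ∈ O) :
    ∃ μ : (V ⧸ O) →ₗ[ℂ] (V ⧸ O) →ₗ[ℂ] (V ⧸ O),
      (∀ a b, μ (O.mkQ a) (O.mkQ b) = O.mkQ (L a b)) ∧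
      (∀ a b, μ (O.mkQ a) (O.mkQ b) = O.mkQ (R b a)) ∧ IsAssocAlg μ (O.mkQ e) := by
  -- Evaluate the commutator at e: L a b ≡ L a (R b e) ≡ R b (L a e) ≡ R b a.
  have hswap : ∀ a b, L a b - R b a ∈ O := by
    intro a b
    have h1 := hL a _ (hRe b)
    have h2 := hLR a b e
    have h3 := hR b _ (hLe a)
    rw [map_sub] at h1 h3
    have := sub_mem (add_mem h2 h3) h1
    rwa [show L a (R b e) - R b (L a e) + (R b (L a e) - R b a) - (L a (R b e) - L a b)
      = L a b - R b a by abel] at this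
  have hL' : ∀ b, ∀ x ∈ O, L x b ∈ O := fun b x hx => by
    simpa using add_mem (hswap x b) (hR b x hx)
  obtain ⟨μ, hμ⟩ := exists_quotient_bilinear O O (L.compr₂ O.mkQ)
    (fun x hx b => (Submodule.Quotient.mk_eq_zero O).2 (hL' b x hx))
    (fun a x hx => (Submodule.Quotient.mk_eq_zero O).2 (hL a x hx))
  replace hμ : ∀ a b, μ (O.mkQ a) (O.mkQ b) = O.mkQ (L a b) := hμ
  have hμ' : ∀ a b, μ (O.mkQ a) (O.mkQ b) = O.mkQ (R b a) := fun a b => by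
    rw [hμ]
    exact (Submodule.Quotient.eq O).2 (hswap a b)
  refine ⟨μ, hμ, hμ', fun x y z => ?_, fun x => ?_, fun x => ?_⟩
  · obtain ⟨a, rfl⟩ := O.mkQ_surjective x
    obtain ⟨b, rfl⟩ := O.mkQ_surjective y
    obtain ⟨c, rfl⟩ := O.mkQ_surjective z
    -- Now (ab)c is R c (L a b) and a(bc) is L a (R c b), so associativity is commutation of L a
    -- with R c.
    rw [hμ, hμ', hμ' b c, hμ]
    exact ((Submodule.Quotient.eq O).2 (hLR a c b)).symm
  · obtain ⟨a, rfl⟩ := O.mkQ_surjective x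
    rw [hμ']
    exact (Submodule.Quotient.eq O).2 (hRe a)
  · obtain ⟨a, rfl⟩ := O.mkQ_surjective x
    rw [hμ]
    exact (Submodule.Quotient.eq O).2 (hLe a)

variable (S : VertexOperatorAlgebra V)

theorem mode_omega_zero_mem_weightSpace {m : ℤ} {a : V} (ha : a ∈ S.weightSpace m) :
    S.mode S.omega 0 a ∈ S.weightSpace (m + 1) := by
  have h : S.mode S.omega 1 (S.mode S.omega 0 a) - S.mode S.omega 0 (S.mode S.omega 1 a)
      = S.mode S.omega 0 a := by simpa [mode] using S.virasoro 0 (-1) a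
  rw [mem_weightSpace_iff] at *
  rw [ha, sub_eq_iff_eq_add] at h
  rw [h, map_smul]
  push_cast
  module

/-- By the derivative axiom, (L(-1)a)_(-2-n) is the nonzero multiple n + 2 of `a_(-3-n)`. -/
theorem mode_neg_mem_C2 (n : ℕ) (a b : V) : S.mode a (-2 - n) b ∈ S.C2 := by
  induction n generalizing a with
  | zero => exact Submodule.subset_span ⟨a, b, by simp⟩
  | succ n ih =>
    have h := ih (S.mode S.omega 0 a)
    have hd : S.mode (S.mode S.omega 0 a) (-2 - n) b
        = (-((-2 - n : ℤ) : ℂ)) • S.mode a (-2 - n - 1) b := S.derivative a b (-2 - n)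
    have h0 : (-((-2 - n : ℤ) : ℂ)) ≠ 0 := by
      rw [neg_ne_zero, Int.cast_ne_zero]
      omega
    rw [hd, Submodule.smul_mem_iff _ h0] at h
    rwa [show (-2 - ((n + 1 : ℕ) : ℤ)) = -2 - n - 1 by push_cast; ring]

/-- The commutator involves only the modes (a_s b)_(n-1-s), whose indices are at most -2. -/
theorem mode_neg_one_commutator_mem_C2 (a b c : V) (n : ℤ) (hn : n ≤ -1) :
    S.mode a (-1) (S.mode b n c) - S.mode b n (S.mode a (-1) c) ∈ S.C2 := by
  obtain ⟨N, hN⟩ := S.exists_mode_eq_zero a b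
  rw [S.mode_commutator a b c (-1) n (N := N.toNat) fun n hn => hN n (by omega)]
  refine Submodule.sum_mem _ fun s _ => Submodule.smul_mem _ _ ?_
  have := S.mode_neg_mem_C2 (-1 - n + s).toNat (S.mode a s b) c
  rwa [show -2 - (((-1 - n + s).toNat : ℕ) : ℤ) = -1 + n - s by omega] at this

theorem exists_product_R : ∃ μ : S.R →ₗ[ℂ] S.R →ₗ[ℂ] S.R,
    (∀ a b : V, μ (S.C2.mkQ a) (S.C2.mkQ b) = S.C2.mkQ (S.mode a (-1) b)) ∧
      IsCommAssocAlg μ (S.C2.mkQ S.vac) := by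
  have hL : ∀ a, ∀ x ∈ S.C2, S.smear 1 (-1) a x ∈ S.C2 := by
    intro a
    change S.C2 ≤ S.C2.comap (S.smear 1 (-1) a)
    refine Submodule.span_le.2 ?_
    rintro _ ⟨b, c, rfl⟩
    change S.smear 1 (-1) a (S.mode b (-2) c) ∈ S.C2
    rw [smear_one]
    have h1 := S.mode_neg_one_commutator_mem_C2 a b c (-2) (by norm_num)
    have h2 : S.mode b (-2) (S.mode a (-1) c) ∈ S.C2 := Submodule.subset_span ⟨_, _, rfl⟩
    simpa using add_mem h1 h2
  have he : ∀ a, S.smear 1 (-1) a S.vac - a ∈ S.C2 := by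
    intro a
    rw [smear_one, show S.mode a (-1) S.vac = a from S.creation_neg_one a, sub_self]
    exact zero_mem _
  obtain ⟨μ, h1, h2, h3⟩ := exists_quotient_product S.C2 (S.smear 1 (-1)) (S.smear 1 (-1)) S.vac
    hL hL (fun a b c => by
      simp only [smear_one]
      exact S.mode_neg_one_commutator_mem_C2 a b c (-1) le_rfl) he he
  refine ⟨μ, fun a b => by rw [h1, smear_one], h3, fun x y => ?_⟩
  obtain ⟨a, rfl⟩ := S.C2.mkQ_surjective x
  obtain ⟨b, rfl⟩ := S.C2.mkQ_surjective y
  rw [h1, h2]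

theorem res_neg_one_vac (α : ℂ) (a : V) : S.res α (-1) a S.vac = a := by
  rw [res, finsum_eq_single _ 0 fun j hj => by
    rw [show S.mode a (j + -1) S.vac = 0 from S.creation a _ (by omega), smul_zero]]
  rw [Ring.choose_zero_right, one_smul]
  exact S.creation_neg_one a

section Twisted

variable {S} {g : V ≃ₗ[ℂ] V} (hg : S.IsAutomorphism g) {T : ℕ}
include hg

theorem IsAutomorphism.mode_omega_zero_mem_eigen {r : ℕ} {a : V} (ha : a ∈ eigen g T r) :
    S.mode S.omega 0 a ∈ eigen g T r :=
  hg.mode_mem_eigen (mem_eigen_zero_iff.2 hg.map_omega) ha 0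

/-- Poles deeper than in the definition are allowed: replacing a by L(-1)a raises the weight by one,
and integration by parts then yields a pole one order deeper, with coefficient 1 + δ(r) + k ≠ 0,
plus a term known by induction. -/
theorem IsAutomorphism.res_mem_Og {r : ℕ} (hr : r < T) (k : ℕ) {m : ℤ} {a : V}
    (ha : a ∈ eigen g T r) (hm : a ∈ S.weightSpace m) (b : V) :
    S.res ((m : ℂ) - 1 + (delta r : ℂ) + r / T) (-1 - delta r - k) a b ∈ S.Og g T := by
  induction k generalizing a m with
  | zero => exact Submodule.subset_span ⟨r, hr, m, a, b, ha, hm, by simp [circ]⟩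
  | succ k ih =>
    have h := ih (hg.mode_omega_zero_mem_eigen ha) (S.mode_omega_zero_mem_weightSpace hm)
    rw [show ((m + 1 : ℤ) : ℂ) - 1 + (delta r : ℂ) + r / T
        = (m : ℂ) - 1 + (delta r : ℂ) + r / T + 1 by push_cast; ring, res_derivative] at h
    have h2 := add_mem h (Submodule.smul_mem _
      (((-1 - delta r - k : ℤ) : ℂ) + ((m : ℂ) - 1 + (delta r : ℂ) + r / T) + 1) (ih ha hm))
    have h0 : (-((-1 - delta r - k : ℤ) : ℂ)) ≠ 0 := by
      rw [neg_ne_zero, Int.cast_ne_zero]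
      unfold delta
      split_ifs <;> omega
    rw [sub_add_cancel, Submodule.smul_mem_iff _ h0] at h2
    rwa [show (-1 - delta r - ((k + 1 : ℕ) : ℤ)) = -1 - delta r - k - 1 by push_cast; ring]

theorem IsAutomorphism.res_succ_mem_Og {r : ℕ} (hr : r < T) (k : ℕ) {m : ℤ} {a : V}
    (ha : a ∈ eigen g T r) (hm : a ∈ S.weightSpace m) (b : V) :
    S.res ((m : ℂ) - 1 + (delta r : ℂ) + r / T + 1) (-1 - delta r - k - 1) a b ∈ S.Og g T := by
  rw [res_succ, sub_add_cancel]
  refine add_mem ?_ (hg.res_mem_Og hr k ha hm b)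
  have := hg.res_mem_Og hr (k + 1) ha hm b
  rwa [show (-1 - delta r - ((k + 1 : ℕ) : ℤ)) = -1 - delta r - k - 1 by push_cast; ring] at this

theorem IsAutomorphism.res_zero_mem_Og (hT : 0 < T) (k : ℕ) {m : ℤ} {a : V}
    (ha : a ∈ eigen g T 0) (hm : a ∈ S.weightSpace m) (b : V) :
    S.res m (-2 - k) a b ∈ S.Og g T := by
  have := hg.res_mem_Og hT k ha hm b
  simpa [delta, sub_add_cancel] using this

theorem IsAutomorphism.res_pos_mem_Og {r : ℕ} (hr0 : 0 < r) (hr : r < T) (k : ℕ) {m : ℤ} {a : V}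
    (ha : a ∈ eigen g T r) (hm : a ∈ S.weightSpace m) (b : V) :
    S.res ((m : ℂ) - 1 + r / T) (-1 - k) a b ∈ S.Og g T := by
  have := hg.res_mem_Og hr k ha hm b
  simpa [delta, hr0.ne'] using this

/-- Take b to be the vacuum, on which the residue returns a. -/
theorem IsAutomorphism.mem_Og_of_mem_eigen {r : ℕ} (hr0 : 0 < r) (hr : r < T) {m : ℤ} {a : V}
    (ha : a ∈ eigen g T r) (hm : a ∈ S.weightSpace m) : a ∈ S.Og g T := by
  have := hg.res_pos_mem_Og hr0 hr 0 ha hm S.vac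
  rwa [Nat.cast_zero, sub_zero, res_neg_one_vac] at this

/-- In the commutator with a generator, `a_s b` has weight m+n-s-1 and the pole is deeper by at
least one. The exponent is the defining one for this weight if α = m-1, and one more if α = m; the
extra factor 1+z costs one pole order. -/
theorem IsAutomorphism.map_smear_mem_Og (α : ℂ) {m : ℤ} (hα : α = m ∨ α = m - 1) {a x : V}
    (ha : a ∈ eigen g T 0) (hm : a ∈ S.weightSpace m) (hx : x ∈ S.Og g T) :
    S.smear (PowerSeries.binomialSeries ℂ α) (-1) a x ∈ S.Og g T := by
  revert x
  change S.Og g T ≤ (S.Og g T).comap (S.smear (PowerSeries.binomialSeries ℂ α) (-1) a)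
  refine Submodule.span_le.2 ?_
  rintro _ ⟨r, hr, n, b, c, hb, hn, rfl⟩
  change S.smear (PowerSeries.binomialSeries ℂ α) (-1) a (S.circ T r n b c) ∈ S.Og g T
  rw [← res_eq_smear]
  have h2 : S.circ T r n b (S.res α (-1) a c) ∈ S.Og g T :=
    Submodule.subset_span ⟨r, hr, n, b, _, hb, hn, rfl⟩
  refine (Submodule.sub_mem_iff_left _ h2).1 (S.res_commutator_mem _ _ _ _ _ _ _ fun s t => ?_)
  have hs := hg.mode_mem_eigen ha hb s
  have hw := S.mode_mem_weightSpace hm hn s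
  rcases hα with rfl | rfl
  · convert hg.res_succ_mem_Og hr t hs hw c using 2
    · push_cast
      ring
    · ring
  · convert hg.res_mem_Og hr (t + 1) hs hw c using 2
    · push_cast
      ring
    · push_cast
      ring

end Twisted

/-- The bilinear map which is `(a, b) ↦ F n a b` for `a ∈ V_n`. -/
def weighted (F : ℤ → V →ₗ[ℂ] V →ₗ[ℂ] V) : V →ₗ[ℂ] V →ₗ[ℂ] V :=
  (DirectSum.toModule ℂ ℤ (V →ₗ[ℂ] V) fun n : ℤ => (F n).comp (S.weightSpace n).subtype).comp
    (LinearEquiv.ofBijective (DirectSum.coeLinearMap S.weightSpace)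
      S.bijective_coeLinearMap).symm.toLinearMap

theorem weighted_of_mem (F : ℤ → V →ₗ[ℂ] V →ₗ[ℂ] V) {n : ℤ} {a : V} (ha : a ∈ S.weightSpace n) :
    S.weighted F a = F n a := by
  have h : (LinearEquiv.ofBijective (DirectSum.coeLinearMap S.weightSpace)
      S.bijective_coeLinearMap).symm a
      = DirectSum.lof ℂ ℤ (fun n => S.weightSpace n) n ⟨a, ha⟩ := by
    rw [LinearEquiv.symm_apply_eq]
    simp
  simp only [weighted, LinearMap.comp_apply, LinearEquiv.coe_coe, h, DirectSum.toModule_lof]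
  rfl

/-- `(a, b) ↦ Res_z (1+z)^(m+i) z⁻¹ Y(a,z) b` for `a ∈ V^0` of weight `m`, and zero for `a ∈ V^r`,
`r ≠ 0`. -/
def zhuMul (g : V ≃ₗ[ℂ] V) (T : ℕ) (i : ℤ) : V →ₗ[ℂ] V →ₗ[ℂ] V :=
  (S.weighted fun m => S.smear (PowerSeries.binomialSeries ℂ ((m + i : ℤ) : ℂ)) (-1)).comp
    (proj g T 0)

theorem zhuMul_of_mem_zero {g : V ≃ₗ[ℂ] V} {T : ℕ} (hT : 0 < T) (i : ℤ) {m : ℤ} {a : V}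
    (ha : a ∈ eigen g T 0) (hm : a ∈ S.weightSpace m) :
    S.zhuMul g T i a = S.smear (PowerSeries.binomialSeries ℂ ((m + i : ℤ) : ℂ)) (-1) a := by
  rw [zhuMul, LinearMap.comp_apply, proj_zero_of_mem_eigen_zero hT ha, weighted_of_mem _ _ hm]

theorem zhuMul_of_mem_pos {g : V ≃ₗ[ℂ] V} {T r : ℕ} (hr0 : 0 < r) (hr : r < T) (i : ℤ) {a : V}
    (ha : a ∈ eigen g T r) : S.zhuMul g T i a = 0 := by
  rw [zhuMul, LinearMap.comp_apply, proj_zero_of_mem_eigen_pos hr0 hr ha, map_zero]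

section Product

variable {S} {g : V ≃ₗ[ℂ] V} (hg : S.IsAutomorphism g) {T : ℕ} (hT : 0 < T) (hgT : g ^ T = 1)
include hg hT hgT

theorem IsAutomorphism.eq_top {U : Submodule ℂ V}
    (h : ∀ n : ℤ, ∀ r < T, ∀ a ∈ eigen g T r, a ∈ S.weightSpace n → a ∈ U) : U = ⊤ := by
  rw [eq_top_iff, ← S.iSup_weightSpace]
  exact iSup_le fun n => hg.weightSpace_le hT hgT (h n)

theorem IsAutomorphism.zhuMul_mem_Og {i : ℤ} (hi : i = 0 ∨ i = -1) (a : V) {x : V}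
    (hx : x ∈ S.Og g T) : S.zhuMul g T i a x ∈ S.Og g T := by
  have h : (S.Og g T).comap ((S.zhuMul g T i).flip x) = ⊤ := by
    refine hg.eq_top hT hgT fun m r hr a ha hm => ?_
    rw [Submodule.mem_comap, LinearMap.flip_apply]
    rcases Nat.eq_zero_or_pos r with rfl | hr0
    · rw [S.zhuMul_of_mem_zero hT i ha hm]
      refine hg.map_smear_mem_Og _ ?_ ha hm hx
      rcases hi with rfl | rfl
      · simp
      · right
        push_cast
        ring
    · rw [S.zhuMul_of_mem_pos hr0 hr i ha]
      exact zero_mem _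
  exact Submodule.eq_top_iff'.1 h a

theorem IsAutomorphism.zhuMul_vac_sub_mem_Og (i : ℤ) (a : V) :
    S.zhuMul g T i a S.vac - a ∈ S.Og g T := by
  have h : (S.Og g T).comap ((S.zhuMul g T i).flip S.vac - LinearMap.id) = ⊤ := by
    refine hg.eq_top hT hgT fun m r hr a ha hm => ?_
    rw [Submodule.mem_comap, LinearMap.sub_apply, LinearMap.flip_apply, LinearMap.id_apply]
    rcases Nat.eq_zero_or_pos r with rfl | hr0
    · rw [S.zhuMul_of_mem_zero hT i ha hm, ← res_eq_smear, res_neg_one_vac, sub_self]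
      exact zero_mem _
    · rw [S.zhuMul_of_mem_pos hr0 hr i ha, LinearMap.zero_apply, zero_sub]
      exact neg_mem (hg.mem_Og_of_mem_eigen hr0 hr ha hm)
  exact Submodule.eq_top_iff'.1 h a

/-- For fixed vectors a, b the exponents m and n-1 give m+n-1-s, exactly the weight of `a_s b`, with
poles of order at least 2. This is why the right multiplication has i = -1. -/
theorem IsAutomorphism.zhuMul_commutator_mem_Og (a b c : V) :
    S.zhuMul g T 0 a (S.zhuMul g T (-1) b c) - S.zhuMul g T (-1) b (S.zhuMul g T 0 a c)
      ∈ S.Og g T := by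
  have h : (S.Og g T).comap ((S.zhuMul g T 0).flip (S.zhuMul g T (-1) b c)
      - (S.zhuMul g T (-1) b).comp ((S.zhuMul g T 0).flip c)) = ⊤ := by
    refine hg.eq_top hT hgT fun m r hr a ha hm => ?_
    have h' : (S.Og g T).comap ((S.zhuMul g T 0 a).comp ((S.zhuMul g T (-1)).flip c)
        - (S.zhuMul g T (-1)).flip (S.zhuMul g T 0 a c)) = ⊤ := by
      refine hg.eq_top hT hgT fun n r' hr' b hb hn => ?_
      change S.zhuMul g T 0 a (S.zhuMul g T (-1) b c) - S.zhuMul g T (-1) b (S.zhuMul g T 0 a c)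
        ∈ S.Og g T
      rcases Nat.eq_zero_or_pos r with rfl | hr0
      · rcases Nat.eq_zero_or_pos r' with rfl | hr0'
        · simp only [S.zhuMul_of_mem_zero hT _ ha hm, S.zhuMul_of_mem_zero hT _ hb hn,
            ← res_eq_smear]
          refine S.res_commutator_mem _ _ _ _ _ _ _ fun s t => ?_
          convert hg.res_zero_mem_Og hT t (hg.mode_mem_eigen ha hb s)
            (S.mode_mem_weightSpace hm hn s) c using 2
          · push_cast
            ring
          · ring
        · simp [S.zhuMul_of_mem_pos hr0' hr' _ hb]
      · simp [S.zhuMul_of_mem_pos hr0 hr _ ha]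
    exact Submodule.eq_top_iff'.1 h' b
  exact Submodule.eq_top_iff'.1 h a

theorem IsAutomorphism.exists_product_Ag : ∃ μ : S.Ag g T →ₗ[ℂ] S.Ag g T →ₗ[ℂ] S.Ag g T,
    S.IsTwistedZhuProduct g T μ ∧ IsAssocAlg μ (S.cls g T S.vac) := by
  obtain ⟨μ, h1, h2, h3⟩ := exists_quotient_product (S.Og g T) (S.zhuMul g T 0) (S.zhuMul g T (-1))
    S.vac (fun a x => hg.zhuMul_mem_Og hT hgT (Or.inl rfl) a)
    (fun a x => hg.zhuMul_mem_Og hT hgT (Or.inr rfl) a) (hg.zhuMul_commutator_mem_Og hT hgT)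
    (hg.zhuMul_vac_sub_mem_Og hT hgT 0) (hg.zhuMul_vac_sub_mem_Og hT hgT (-1))
  refine ⟨μ, ⟨fun m a b ha hm => ?_, fun r a b hr0 hr ha => ?_⟩, h3⟩
  · rw [h1, S.zhuMul_of_mem_zero hT 0 ha hm, add_zero, ← res_eq_smear]
  · rw [h1, S.zhuMul_of_mem_pos hr0 hr 0 ha, LinearMap.zero_apply, map_zero]

end Product

end

/-! ### The weight filtration and its associated graded algebra -/

section

variable {V : Type*} [AddCommGroup V] [Module ℂ V] {S : VertexOperatorAlgebra V}

theorem filt_mono (g : V ≃ₗ[ℂ] V) (T : ℕ) {m n : ℤ} (h : m ≤ n) : S.filt g T m ≤ S.filt g T n :=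
  Submodule.map_mono (S.weightLE_mono h)

theorem cls_eq_zero {g : V ≃ₗ[ℂ] V} {T : ℕ} {a : V} (h : a ∈ S.Og g T) : S.cls g T a = 0 :=
  (Submodule.Quotient.mk_eq_zero _).2 h

/-- A leading term a of a relation x is congruent to minus the lower terms, so its class drops in
the filtration. -/
theorem cls_mem_filt_of_sub {g : V ≃ₗ[ℂ] V} {T : ℕ} {n : ℤ} {x a : V} (hx : x ∈ S.Og g T)
    (h : x - a ∈ S.weightLE n) : S.cls g T a ∈ S.filt g T n := by
  have := Submodule.mem_map_of_mem (f := S.cls g T) h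
  rw [map_sub, cls_eq_zero hx, zero_sub] at this
  exact neg_mem_iff.1 this

theorem symb_eq_zero {g : V ≃ₗ[ℂ] V} {T n : ℕ} {x : S.filt g T n}
    (h : (x : S.Ag g T) ∈ S.filt g T ((n : ℤ) - 1)) : S.symb g T n x = 0 := by
  have h' : ((S.filt g T ((n : ℤ) - 1)).submoduleOf (S.filt g T n)).mkQ x = 0 :=
    (Submodule.Quotient.mk_eq_zero _).2 h
  rw [symb, LinearMap.comp_apply, h', map_zero]

theorem symb_eq_symb {g : V ≃ₗ[ℂ] V} {T n : ℕ} {x y : S.filt g T n}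
    (h : (x : S.Ag g T) - y ∈ S.filt g T ((n : ℤ) - 1)) : S.symb g T n x = S.symb g T n y := by
  rw [← sub_add_cancel x y, map_add, symb_eq_zero (x := x - y) h, zero_add]

theorem IsCFTType.linearMap_ext (hV : S.IsCFTType) {W : Type*} [AddCommMonoid W] [Module ℂ W]
    {f h : V →ₗ[ℂ] W} (H : ∀ n : ℕ, ∀ a ∈ S.weightSpace n, f a = h a) : f = h := by
  have : LinearMap.eqLocus f h = ⊤ := by
    rw [eq_top_iff, ← hV.iSup_weightSpace_nat]
    exact iSup_le fun n a ha => H n a ha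
  exact LinearMap.ext fun a => Submodule.eq_top_iff'.1 this a

section

variable (hV : S.IsCFTType) {g : V ≃ₗ[ℂ] V} (hg : S.IsAutomorphism g) {T : ℕ} (hT : 0 < T)
  (hgT : g ^ T = 1)
include hV hg hT hgT

theorem mode_neg_two_mem_filt {m n d : ℤ} {a b : V} (ha : a ∈ S.weightSpace m)
    (hb : b ∈ S.weightSpace n) (hd : m + n ≤ d) : S.cls g T (S.mode a (-2) b) ∈ S.filt g T d := by
  have h : S.weightSpace m ≤ (S.filt g T d).comap ((S.cls g T).comp ((S.smear 1 (-2)).flip b)) := by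
    refine hg.weightSpace_le hT hgT fun r hr a har ha => ?_
    rw [Submodule.mem_comap, LinearMap.comp_apply, LinearMap.flip_apply, smear_one]
    rcases Nat.eq_zero_or_pos r with rfl | hr0
    · exact cls_mem_filt_of_sub (hg.res_zero_mem_Og hT 0 har ha b)
        (hV.res_sub_mode_mem_weightLE ha hb _ _ (by omega))
    -- For r ≠ 0 the defining pole is only z⁻¹, so z⁻² is the case k = 1.
    · exact cls_mem_filt_of_sub (hg.res_pos_mem_Og hr0 hr 1 har ha b)
        (hV.res_sub_mode_mem_weightLE ha hb _ _ (by omega))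
  have := h ha
  rwa [Submodule.mem_comap, LinearMap.comp_apply, LinearMap.flip_apply, smear_one] at this

theorem grMap_mode_neg_two (a b : V) : S.grMap g T (S.mode a (-2) b) = 0 := by
  have h : (S.smear 1 (-2)).compr₂ (S.grMap g T) = 0 := by
    refine hV.linearMap_ext fun m a ha => hV.linearMap_ext fun n b hb => ?_
    rw [LinearMap.compr₂_apply, smear_one, LinearMap.zero_apply, LinearMap.zero_apply]
    have hab : S.mode a (-2) b ∈ S.weightSpace ((m + n + 1 : ℕ) : ℤ) := by
      convert S.mode_mem_weightSpace ha hb (-2) using 2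
      push_cast
      ring
    rw [S.grMap_of_mem g T (m + n + 1) hab]
    exact symb_eq_zero (mode_neg_two_mem_filt hV hg hT hgT ha hb (by push_cast; omega))
  have := LinearMap.congr_fun₂ h a b
  rwa [LinearMap.compr₂_apply, smear_one] at this

theorem grMap_eq_zero_of_mem_C2 {c : V} (hc : c ∈ S.C2) : S.grMap g T c = 0 := by
  have : S.C2 ≤ LinearMap.ker (S.grMap g T) := by
    refine Submodule.span_le.2 ?_
    rintro _ ⟨a, b, rfl⟩
    exact grMap_mode_neg_two hV hg hT hgT a b
  exact this hc

omit hV hg hT hgT in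
theorem grMap_surjective (g : V ≃ₗ[ℂ] V) (T : ℕ) : Function.Surjective (S.grMap g T) := by
  rw [← LinearMap.range_eq_top, eq_top_iff]
  rintro y -
  have key : ∀ (n : ℕ) (x : S.filt g T n), S.symb g T n x ∈ LinearMap.range (S.grMap g T) := by
    rintro n ⟨_, w, hw, rfl⟩
    have h : S.weightLE n ≤ (Submodule.map (S.filt g T n).subtype
        ((LinearMap.range (S.grMap g T)).comap (S.symb g T n))).comap (S.cls g T) := by
      refine S.weightLE_le_iff.2 fun i hi a ha => ?_
      refine ⟨⟨S.cls g T a, filt_mono g T hi (S.cls_mem_filt g T i ha)⟩, ?_, rfl⟩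
      change S.symb g T n _ ∈ LinearMap.range (S.grMap g T)
      rcases eq_or_lt_of_le (Nat.cast_le.1 hi) with rfl | hlt
      · exact ⟨a, S.grMap_of_mem g T i ha⟩
      -- Weights below n have zero symbol in degree n.
      · rw [symb_eq_zero (filt_mono g T (by omega) (S.cls_mem_filt g T i ha))]
        exact zero_mem _
    obtain ⟨x, hx, hxw⟩ := h hw
    obtain rfl : x = ⟨S.cls g T w, Submodule.mem_map_of_mem hw⟩ := Subtype.ext hxw
    exact hx
  induction y using DirectSum.induction_on with
  | zero => exact zero_mem _
  | of n x =>
    obtain ⟨x, rfl⟩ := Submodule.mkQ_surjective _ x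
    exact key n x
  | add x y hx hy => exact add_mem hx hy

variable {μ : S.Ag g T →ₗ[ℂ] S.Ag g T →ₗ[ℂ] S.Ag g T} (hμ : S.IsTwistedZhuProduct g T μ)
include hμ

theorem IsTwistedZhuProduct.sub_mem_filt {m n d : ℤ} {a b : V} (ha : a ∈ S.weightSpace m)
    (hb : b ∈ S.weightSpace n) (hd : m + n - 1 ≤ d) :
    μ (S.cls g T a) (S.cls g T b) - S.cls g T (S.mode a (-1) b) ∈ S.filt g T d := by
  have h : S.weightSpace m ≤ (S.filt g T d).comap ((μ.flip (S.cls g T b)).comp (S.cls g T)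
      - (S.cls g T).comp ((S.smear 1 (-1)).flip b)) := by
    refine hg.weightSpace_le hT hgT fun r hr a har ha => ?_
    rw [Submodule.mem_comap, LinearMap.sub_apply, LinearMap.comp_apply, LinearMap.comp_apply,
      LinearMap.flip_apply, LinearMap.flip_apply, smear_one]
    rcases Nat.eq_zero_or_pos r with rfl | hr0
    · rw [hμ.of_mem_zero m a b har ha, ← map_sub]
      exact Submodule.mem_map_of_mem (hV.res_sub_mode_mem_weightLE ha hb _ _ (by omega))
    -- The product is zero here, and the class of `a_(-1) b` itself drops, being the leading term of
    -- an element of `Og`.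
    · rw [hμ.of_mem_pos r a b hr0 hr har, zero_sub]
      exact neg_mem (cls_mem_filt_of_sub (hg.res_pos_mem_Og hr0 hr 0 har ha b)
        (hV.res_sub_mode_mem_weightLE ha hb _ _ (by omega)))
  have := h ha
  rwa [Submodule.mem_comap, LinearMap.sub_apply, LinearMap.comp_apply, LinearMap.comp_apply,
    LinearMap.flip_apply, LinearMap.flip_apply, smear_one] at this

theorem IsTwistedZhuProduct.mem_filt {m n d : ℤ} (hd : m + n ≤ d) {x y : S.Ag g T}
    (hx : x ∈ S.filt g T m) (hy : y ∈ S.filt g T n) : μ x y ∈ S.filt g T d := by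
  obtain ⟨a, ha, rfl⟩ := hx
  obtain ⟨b, hb, rfl⟩ := hy
  have h1 : S.weightLE m ≤ (S.filt g T d).comap ((μ.flip (S.cls g T b)).comp (S.cls g T)) := by
    refine S.weightLE_le_iff.2 fun i hi a ha => ?_
    have h2 : S.weightLE n ≤ (S.filt g T d).comap ((μ (S.cls g T a)).comp (S.cls g T)) := by
      refine S.weightLE_le_iff.2 fun j hj b hb => ?_
      have h3 := hμ.sub_mem_filt hV hg hT hgT ha hb (d := d) (by omega)
      have h4 : S.cls g T (S.mode a (-1) b) ∈ S.filt g T d :=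
        Submodule.mem_map_of_mem (hV.mode_mem_weightLE ha hb (by omega))
      simpa using add_mem h3 h4
    exact h2 hb
  exact h1 ha

theorem IsTwistedZhuProduct.exists_isGrProduct :
    ∃ μG : S.Gr g T →ₗ[ℂ] S.Gr g T →ₗ[ℂ] S.Gr g T, S.IsGrProduct g T μ μG := by
  have hmem : ∀ (m n : ℕ) (x : S.filt g T m) (y : S.filt g T n),
      μ x y ∈ S.filt g T ((m + n : ℕ) : ℤ) := fun m n x y =>
    hμ.mem_filt hV hg hT hgT (by push_cast; omega) x.2 y.2
  have hB : ∀ m n : ℕ, ∃ B : (S.filt g T m ⧸ (S.filt g T ((m : ℤ) - 1)).submoduleOf (S.filt g T m))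
      →ₗ[ℂ] (S.filt g T n ⧸ (S.filt g T ((n : ℤ) - 1)).submoduleOf (S.filt g T n)) →ₗ[ℂ] S.Gr g T,
      ∀ x y, B (Submodule.mkQ _ x) (Submodule.mkQ _ y)
        = S.symb g T (m + n) ⟨μ x y, hmem m n x y⟩ := by
    intro m n
    refine exists_quotient_bilinear _ _ (LinearMap.mk₂ ℂ
      (fun (x : S.filt g T m) (y : S.filt g T n) =>
        S.symb g T (m + n) ⟨μ x y, hmem m n x y⟩) ?_ ?_ ?_ ?_) ?_ ?_
    · intro x x' y
      rw [← map_add]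
      congr 1
      ext
      simp
    · intro c x y
      rw [← map_smul]
      congr 1
      ext
      simp
    · intro x y y'
      rw [← map_add]
      congr 1
      ext
      simp
    · intro c x y
      rw [← map_smul]
      congr 1
      ext
      simp
    · intro x hx y
      exact symb_eq_zero (hμ.mem_filt hV hg hT hgT (by push_cast; omega) hx y.2)
    · intro x y hy
      exact symb_eq_zero (hμ.mem_filt hV hg hT hgT (by push_cast; omega) x.2 hy)
  choose B hB using hB
  refine ⟨DirectSum.toModule ℂ ℕ _ fun m =>
    (DirectSum.toModule ℂ ℕ _ fun n => (B m n).flip).flip, fun m n x y => ⟨hmem m n x y, ?_⟩⟩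
  rw [symb, symb, LinearMap.comp_apply, LinearMap.comp_apply, DirectSum.toModule_lof,
    LinearMap.flip_apply, DirectSum.toModule_lof, LinearMap.flip_apply, hB]

theorem IsTwistedZhuProduct.grMap_mode_neg_one {μG : S.Gr g T →ₗ[ℂ] S.Gr g T →ₗ[ℂ] S.Gr g T}
    (hG : S.IsGrProduct g T μ μG) (a b : V) :
    S.grMap g T (S.mode a (-1) b) = μG (S.grMap g T a) (S.grMap g T b) := by
  have h : (S.smear 1 (-1)).compr₂ (S.grMap g T) = μG.compl₁₂ (S.grMap g T) (S.grMap g T) := by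
    refine hV.linearMap_ext fun m a ha => hV.linearMap_ext fun n b hb => ?_
    rw [LinearMap.compr₂_apply, smear_one, LinearMap.compl₁₂_apply]
    have hab : S.mode a (-1) b ∈ S.weightSpace ((m + n : ℕ) : ℤ) := by
      convert S.mode_mem_weightSpace ha hb (-1) using 2
      push_cast
      ring
    obtain ⟨h1, h2⟩ := hG m n ⟨S.cls g T a, S.cls_mem_filt g T m ha⟩
      ⟨S.cls g T b, S.cls_mem_filt g T n hb⟩
    rw [S.grMap_of_mem g T _ hab, S.grMap_of_mem g T _ ha, S.grMap_of_mem g T _ hb, h2]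
    refine (symb_eq_symb ?_).symm
    exact hμ.sub_mem_filt hV hg hT hgT ha hb (by push_cast; omega)
  have := LinearMap.congr_fun₂ h a b
  rwa [LinearMap.compr₂_apply, smear_one, LinearMap.compl₁₂_apply] at this

end

/-- Transfers the algebra laws from R(V) to the graded algebra, so none is checked there directly.
-/
theorem IsCommAssocAlg.of_surjective {X Y : Type*} [AddCommMonoid X] [Module ℂ X] [AddCommMonoid Y]
    [Module ℂ Y] {μ : X →ₗ[ℂ] X →ₗ[ℂ] X} {e : X} (h : IsCommAssocAlg μ e)
    {ν : Y →ₗ[ℂ] Y →ₗ[ℂ] Y} (φ : X →ₗ[ℂ] Y) (hφ : Function.Surjective φ)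
    (hmul : ∀ x y, φ (μ x y) = ν (φ x) (φ y)) : IsCommAssocAlg ν (φ e) where
  assoc := hφ.forall₃.2 fun x y z => by simp only [← hmul, h.assoc]
  one_mul := hφ.forall.2 fun x => by rw [← hmul, h.one_mul]
  mul_one := hφ.forall.2 fun x => by rw [← hmul, h.mul_one]
  comm := hφ.forall₂.2 fun x y => by rw [← hmul, ← hmul, h.comm]

end

end VertexOperatorAlgebra

end

theorem mainTheorem12 {V : Type*} [AddCommGroup V] [Module ℂ V] (S : VertexOperatorAlgebra V)
    (hV : S.IsCFTType) (g : V ≃ₗ[ℂ] V) (hg : S.IsAutomorphism g) (T : ℕ) (hT : 0 < T)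
    (hgT : orderOf g = T) :
    -- the products of `R(V)`, of `A_g(V)` and of `gr A_g(V)` are well defined
    ∃ (μR : S.R →ₗ[ℂ] S.R →ₗ[ℂ] S.R) (μA : S.Ag g T →ₗ[ℂ] S.Ag g T →ₗ[ℂ] S.Ag g T)
      (μG : S.Gr g T →ₗ[ℂ] S.Gr g T →ₗ[ℂ] S.Gr g T),
      (∀ a b : V, μR (S.C2.mkQ a) (S.C2.mkQ b) = S.C2.mkQ (S.mode a (-1) b)) ∧
      VertexOperatorAlgebra.IsCommAssocAlg μR (S.C2.mkQ S.vac) ∧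
      S.IsTwistedZhuProduct g T μA ∧
      VertexOperatorAlgebra.IsAssocAlg μA (S.cls g T S.vac) ∧
      S.IsGrProduct g T μA μG ∧
      VertexOperatorAlgebra.IsCommAssocAlg μG (S.grOne g T) ∧
      -- the map `V → gr A_g(V)` kills `C_2(V)`
      (∀ c ∈ S.C2, S.grMap g T c = 0) ∧
      -- and induces an epimorphism of algebras `R(V) → gr A_g(V)`
      ∃ φ : S.R →ₗ[ℂ] S.Gr g T,
        (∀ a : V, φ (S.C2.mkQ a) = S.grMap g T a) ∧
        (∀ (m : ℕ) (a : V) (ha : a ∈ S.weightSpace m),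
          φ (S.C2.mkQ a) = S.symb g T m ⟨S.cls g T a, S.cls_mem_filt g T m ha⟩) ∧
        φ (S.C2.mkQ S.vac) = S.grOne g T ∧
        (∀ x y : S.R, φ (μR x y) = μG (φ x) (φ y)) ∧
        Function.Surjective φ := by
  have hgT' : g ^ T = 1 := hgT ▸ pow_orderOf_eq_one g
  obtain ⟨μR, hR, hRalg⟩ := S.exists_product_R
  obtain ⟨μA, hA, hAalg⟩ := hg.exists_product_Ag hT hgT'
  obtain ⟨μG, hG⟩ := hA.exists_isGrProduct hV hg hT hgT'
  have hC : ∀ c ∈ S.C2, S.grMap g T c = 0 := fun c hc =>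
    VertexOperatorAlgebra.grMap_eq_zero_of_mem_C2 hV hg hT hgT' hc
  obtain ⟨φ, hφ⟩ := VertexOperatorAlgebra.exists_quotient_linear S.C2 (S.grMap g T) hC
  have hone : φ (S.C2.mkQ S.vac) = S.grOne g T :=
    (hφ _).trans (S.grMap_of_mem g T 0 S.vac_mem_weightSpace)
  have hmul : ∀ x y : S.R, φ (μR x y) = μG (φ x) (φ y) := by
    intro x y
    obtain ⟨a, rfl⟩ := S.C2.mkQ_surjective x
    obtain ⟨b, rfl⟩ := S.C2.mkQ_surjective y
    rw [hR, hφ, hφ, hφ, hA.grMap_mode_neg_one hV hg hT hgT' hG]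
  have hsurj : Function.Surjective φ := fun y => by
    obtain ⟨a, ha⟩ := VertexOperatorAlgebra.grMap_surjective g T y
    exact ⟨S.C2.mkQ a, (hφ a).trans ha⟩
  exact ⟨μR, μA, μG, hR, hRalg, hA, hAalg, hG, hone ▸ hRalg.of_surjective φ hsurj hmul, hC, φ, hφ,
    fun m a ha => (hφ a).trans (S.grMap_of_mem g T m ha), hone, hmul, hsurj⟩
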